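/- **Setting.** Let $F_1,\dots,F_n:\mathbb R^p\to\mathbb R^p$ with $n\ge 1$, $Fx:=\frac1n\sum_{i=1}^nF_ix$, and let $T:\mathbb R^p\rightrightarrows 2^{\mathbb R^p}$ be multi-valued. Consider the inclusion $0\in Fx+Tx$. Let $L>0$, $\hat L>L$ and $\rho\ge 0$ with $\hat L\rho<1$. Assume that * the inclusion has a solution $x^\star$; * $T$ is maximally $\rho$-co-hypomonotone, i.e. $\langle u-v,x-y\rangle\ge-\rho\|u-v\|^2$ for all $(x,u),(y,v)$ in the graph of $T$, and this graph is not properly contained in the graph of another operator with this property; * $F$ is $\frac1L$-average co-coercive: $\langle Fx-Fy,x-y\rangle\ge\frac1{nL}\sum_{i=1}^n\|F_ix-F_iy\|^2$ for all $x,y$. For $\lambda>0$ let $J_{\lambda T}$ be the resolvent of $\lambda T$ and $G_\lambda x:=\frac1\lambda\big(x-J_{\lambda T}(x-\lambda Fx)\big)$. **Parameters.** Let $$2\rho\le\lambda<\tfrac{2(1+\sqrt{1-\hat L\rho})}{\hat L},\quad \lambda>0,\quad 0<\mu<\tfrac23,\quad r>5+\tfrac1\mu,\quad 0<\beta\le\tfrac{(2-\mu)\bar\beta}{2+\mu},\quad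 c_p>0,\quad \omega\in[0,1],$$ where $\bar\beta:=\frac{\lambda(4-\hat L\lambda)-4\rho}{4(1-\rho\hat L)}$. Put $\Lambda:=\frac{\hat L-L}{L\hat L}$, $\nu:=\frac\mu2$, $t_k:=\mu(k+r)$, $\eta_k:=\frac{2\beta(t_k-1)}{t_k-\nu}$, $c_b:=\frac{5\beta c_p^2}{\mu\Lambda}$, $b:=\lfloor c_bn^{2\omega}\rfloor$ and $$\mathbf p_k:=\begin{cases}\frac{2}{c_pn^\omega}+\frac{4\mu}{\mu(k+r-1)-1}&\text{if }0\le k\le\lfloor 4c_pn^\omega-r+1+\mu^{-1}\rfloor,\\ \frac{3}{c_pn^\omega}&\text{otherwise.}\end{cases}$$ Assume that $n^\omega\ge\frac1{c_p}\max\big\{\frac{2\mu(r-1)-2}{\mu(r-5)-1},\frac{\mu(r-1)-1}{4\mu}\big\}$ and that the batch size satisfies $b\ge1$. **Algorithm.** Let $x^0\in\mathbb R^p$ and $\tilde x^0:=z^0:=x^0$. At iteration $k\ge0$: if $k\ge1$, set $\tilde x^k:=x^{k-1}$ with probability $\mathbf p_k$ and $\tilde x^k:=\tilde x^{k-1}$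 otherwise; draw $i_1,\dots,i_b$ independently and uniformly from $\{1,\dots,n\}$; and compute $$\widetilde F^k:=F\tilde x^k+\tfrac1b\sum_{j=1}^bF_{i_j}x^k-\tfrac1b\sum_{j=1}^bF_{i_j}\tilde x^k,\qquad \widetilde G^k:=\tfrac1\lambda\big(x^k-J_{\lambda T}(x^k-\lambda\widetilde F^k)\big),$$ $$y^k:=\tfrac{t_k-1}{t_k}x^k+\tfrac1{t_k}z^k,\qquad x^{k+1}:=y^k-\eta_k\widetilde G^k,\qquad z^{k+1}:=z^k+\nu(x^{k+1}-y^k).$$ All samples and switches are mutually independent. The vector $F\tilde x^k$ is stored: it costs $n$ evaluations of components $F_i$ at the start and whenever the switch moves the snapshot point to $x^{k-1}$. Besides, each iteration costs $2b$ evaluations of components $F_i$ and one evaluation of $J_{\lambda T}$. **Claim.** Let $\Psi_0:=\Big(\mu^2r^2\|G_\lambda x^0\|^2+\frac{2r-1}{4\beta^2(\mu r-1)}\|x^0-x^\star\|^2\Big)^{1/2}$. For every $\epsilon>0$ there is a $K\ge0$ with $\mathbb E\|G_\lambda x^K\|^2\le\epsilon^2$ such that the expected number of evaluations of components $F_i$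 made to obtain $x^K$, and likewise the number of evaluations of $J_{\lambda T}$, is at most $$\bar{\mathcal T}:=\Big\lfloor n+4n\big[2+\ln(4c_pn^\omega)\big]+\tfrac{\sqrt2\,\Psi_0}{\mu\epsilon}\Big(2c_bn^{2\omega}+\tfrac{3n^{1-\omega}}{c_p}\Big)\Big\rfloor ,$$ the number of evaluations of $J_{\lambda T}$ being also at most $\frac{\sqrt2\Psi_0}{\mu\epsilon}$. If $\omega=\frac13$, then $\bar{\mathcal T}$, and with it the expected total number of evaluations of components $F_i$ and of $J_{\lambda T}$, is $O\big(n\ln n+\frac{n^{2/3}}{\epsilon}\big)$: for every $\Psi_{\max}$ there is a constant $C$, depending only on $L,\hat L,\rho,\lambda,\mu,r,\beta,c_p$ and $\Psi_{\max}$, such that both are at most $C\big(n\ln n+\frac{n^{2/3}}\epsilon\big)$ for all $n\ge2$, all $\epsilon>0$ and all problems as above with $\Psi_0\le\Psi_{\max}$. -/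

import Mathlib

open MeasureTheory ProbabilityTheory

namespace VFOSA

/-! ### Operators -/

/-- `T` is `ρ`-co-hypomonotone. A multi-valued operator is a map into sets. -/
def CoHypomonotone {p : ℕ} (ρ : ℝ)
    (T : EuclideanSpace ℝ (Fin p) → Set (EuclideanSpace ℝ (Fin p))) : Prop :=
  ∀ x y u v, u ∈ T x → v ∈ T y → -ρ * ‖u - v‖ ^ 2 ≤ inner ℝ (u - v) (x - y)

/-- `T` is maximally `ρ`-co-hypomonotone: its graph is not properly contained in the graph of
another `ρ`-co-hypomonotone operator. -/
def MaxCoHypomonotone {p : ℕ} (ρ : ℝ)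
    (T : EuclideanSpace ℝ (Fin p) → Set (EuclideanSpace ℝ (Fin p))) : Prop :=
  CoHypomonotone ρ T ∧
    ∀ T' : EuclideanSpace ℝ (Fin p) → Set (EuclideanSpace ℝ (Fin p)),
      CoHypomonotone ρ T' → (∀ x, T x ⊆ T' x) → ∀ x, T' x ⊆ T x

/-- The set `{w : u ∈ w + lam • T w}`, i.e. the value at `u` of the resolvent of `lam • T`
as a multi-valued operator. -/
def resolventSet {p : ℕ} (lam : ℝ)
    (T : EuclideanSpace ℝ (Fin p) → Set (EuclideanSpace ℝ (Fin p)))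
    (u : EuclideanSpace ℝ (Fin p)) : Set (EuclideanSpace ℝ (Fin p)) :=
  {w | ∃ v ∈ T w, w + lam • v = u}

open Classical in
/-- The resolvent of `lam • T` as a map: an element of `resolventSet lam T u`
(and `0` if there is none). -/
noncomputable def resolvent {p : ℕ} (lam : ℝ)
    (T : EuclideanSpace ℝ (Fin p) → Set (EuclideanSpace ℝ (Fin p)))
    (u : EuclideanSpace ℝ (Fin p)) : EuclideanSpace ℝ (Fin p) :=
  if h : (resolventSet lam T u).Nonempty then h.some else 0

/-- The finite-sum operator `F x = (1 / n) * ∑ i, F_i x`. -/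
noncomputable def avg {p n : ℕ}
    (F : Fin n → EuclideanSpace ℝ (Fin p) → EuclideanSpace ℝ (Fin p))
    (x : EuclideanSpace ℝ (Fin p)) : EuclideanSpace ℝ (Fin p) :=
  (1 / (n : ℝ)) • ∑ i, F i x

/-- The solution set of the inclusion `0 ∈ F x + T x`. -/
def zer {p : ℕ} (F : EuclideanSpace ℝ (Fin p) → EuclideanSpace ℝ (Fin p))
    (T : EuclideanSpace ℝ (Fin p) → Set (EuclideanSpace ℝ (Fin p))) :
    Set (EuclideanSpace ℝ (Fin p)) :=
  {x | ∃ v ∈ T x, F x + v = 0}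

/-- `F` is `1 / L`-average co-coercive. -/
def AverageCocoercive {p n : ℕ} (L : ℝ)
    (F : Fin n → EuclideanSpace ℝ (Fin p) → EuclideanSpace ℝ (Fin p)) : Prop :=
  ∀ x y, 1 / ((n : ℝ) * L) * ∑ i, ‖F i x - F i y‖ ^ 2 ≤ inner ℝ (avg F x - avg F y) (x - y)

/-- The forward-backward splitting residual
`G x = (1 / lam) * (x - J (x - lam * F x))`, with `J` the resolvent of `lam • T`. -/
noncomputable def residual {p : ℕ} (lam : ℝ)
    (F : EuclideanSpace ℝ (Fin p) → EuclideanSpace ℝ (Fin p))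
    (T : EuclideanSpace ℝ (Fin p) → Set (EuclideanSpace ℝ (Fin p)))
    (x : EuclideanSpace ℝ (Fin p)) : EuclideanSpace ℝ (Fin p) :=
  (1 / lam) • (x - resolvent lam T (x - lam • F x))

/-! ### Parameters -/

noncomputable def betaBar (Lhat ρ lam : ℝ) : ℝ :=
  (lam * (4 - Lhat * lam) - 4 * ρ) / (4 * (1 - ρ * Lhat))

noncomputable def bigLambda (L Lhat : ℝ) : ℝ := (Lhat - L) / (L * Lhat)

/-- The conditions on the constants that involve neither the number `n` of summands nor the
operators. -/
structure Constants (L Lhat ρ lam μ r β cp : ℝ) : Prop where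
  L_pos : 0 < L
  L_lt : L < Lhat
  ρ_nonneg : 0 ≤ ρ
  Lhat_mul_lt : Lhat * ρ < 1
  lam_pos : 0 < lam
  lam_ge : 2 * ρ ≤ lam
  lam_lt : lam < 2 * (1 + √(1 - Lhat * ρ)) / Lhat
  μ_pos : 0 < μ
  μ_lt : μ < 2 / 3
  r_gt : 5 + 1 / μ < r
  β_pos : 0 < β
  β_le : β ≤ (2 - μ) * betaBar Lhat ρ lam / (2 + μ)
  cp_pos : 0 < cp

/-- The constant `c_b = 5 β c_p² / (μ Λ)`. -/
noncomputable def batchConst (L Lhat μ β cp : ℝ) : ℝ :=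
  5 * β * cp ^ 2 / (μ * bigLambda L Lhat)

/-- The mini-batch size `b = ⌊c_b n ^ (2 a)⌋`, for the exponent `a`. -/
noncomputable def batchSize (L Lhat μ β cp a : ℝ) (n : ℕ) : ℕ :=
  ⌊batchConst L Lhat μ β cp * (n : ℝ) ^ (2 * a)⌋₊

/-- The conditions that relate the number `n` of summands and the exponent `a` to the constants;
`batch` says that the batch size is at least one. -/
structure SizeConditions (L Lhat μ r β cp a : ℝ) (n : ℕ) : Prop where
  n_pos : 1 ≤ n
  a_nonneg : 0 ≤ a
  a_le_one : a ≤ 1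
  large : 1 / cp * max ((2 * μ * (r - 1) - 2) / (μ * (r - 5) - 1)) ((μ * (r - 1) - 1) / (4 * μ))
    ≤ (n : ℝ) ^ a
  batch : 1 ≤ batchSize L Lhat μ β cp a n

/-- The switching probability `p_k`. -/
noncomputable def switchProb (μ r cp a : ℝ) (n k : ℕ) : ℝ :=
  if (k : ℤ) ≤ ⌊4 * cp * (n : ℝ) ^ a - r + 1 + 1 / μ⌋ then
    2 / (cp * (n : ℝ) ^ a) + 4 * μ / (μ * ((k : ℝ) + r - 1) - 1)
  else 3 / (cp * (n : ℝ) ^ a)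

noncomputable def tSeq (μ r : ℝ) (k : ℕ) : ℝ := μ * ((k : ℝ) + r)

noncomputable def etaSeq (μ r β : ℝ) (k : ℕ) : ℝ :=
  2 * β * (tSeq μ r k - 1) / (tSeq μ r k - μ / 2)

/-- The constant `Ψ₀ = (μ² r² ‖G x⁰‖² + (2 r - 1) / (4 β² (μ r - 1)) ‖x⁰ - x⋆‖²) ^ (1 / 2)`. -/
noncomputable def Psi0 {p : ℕ} (lam μ r β : ℝ)
    (F : EuclideanSpace ℝ (Fin p) → EuclideanSpace ℝ (Fin p))
    (T : EuclideanSpace ℝ (Fin p) → Set (EuclideanSpace ℝ (Fin p)))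
    (x0 xstar : EuclideanSpace ℝ (Fin p)) : ℝ :=
  √(μ ^ 2 * r ^ 2 * ‖residual lam F T x0‖ ^ 2
    + (2 * r - 1) / (4 * β ^ 2 * (μ * r - 1)) * ‖x0 - xstar‖ ^ 2)

/-- The complexity bound
`⌊n + 4 n (2 + ln (4 c_p n ^ a)) + (√2 Ψ / (μ ε)) (2 c_b n ^ (2 a) + 3 n ^ (1 - a) / c_p)⌋`. -/
noncomputable def complexity (L Lhat μ β cp a : ℝ) (n : ℕ) (Ψ ε : ℝ) : ℤ :=
  ⌊(n : ℝ) + 4 * n * (2 + Real.log (4 * cp * (n : ℝ) ^ a))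
    + √2 * Ψ / (μ * ε)
      * (2 * batchConst L Lhat μ β cp * (n : ℝ) ^ (2 * a) + 3 * (n : ℝ) ^ (1 - a) / cp)⌋

/-! ### The algorithm -/

/-- What the algorithm stores before iteration `k`: the iterates `x^k`, `x^{k-1}`, `z^k`, the
last snapshot point `x̃^{k-1}` with the stored vector `F x̃^{k-1}`, and the numbers of evaluations
of components `F_i` and of the resolvent made so far. -/
structure State (p : ℕ) where
  x : EuclideanSpace ℝ (Fin p)
  xprev : EuclideanSpace ℝ (Fin p)
  z : EuclideanSpace ℝ (Fin p)
  snap : EuclideanSpace ℝ (Fin p)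
  Fsnap : EuclideanSpace ℝ (Fin p)
  fCalls : ℕ
  jCalls : ℕ

/-- The initial state: `x⁻¹ = z⁰ = x̃⁰ = x⁰`, after the `n` evaluations that `F x⁰` takes. -/
noncomputable def initState {p n : ℕ}
    (F : Fin n → EuclideanSpace ℝ (Fin p) → EuclideanSpace ℝ (Fin p))
    (x0 : EuclideanSpace ℝ (Fin p)) : State p where
  x := x0
  xprev := x0
  z := x0
  snap := x0
  Fsnap := avg F x0
  fCalls := n
  jCalls := 0

/-- Iteration `k`, given the mini-batch `s` of size `b` and the outcome `c` of the switch.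
For `k ≥ 1`, if `c` holds, the snapshot point is moved to `x^{k-1}`, where all the `n` components
are evaluated; the estimator evaluates each sampled component at two points. -/
noncomputable def step {p n b : ℕ} (lam μ r β : ℝ)
    (F : Fin n → EuclideanSpace ℝ (Fin p) → EuclideanSpace ℝ (Fin p))
    (T : EuclideanSpace ℝ (Fin p) → Set (EuclideanSpace ℝ (Fin p)))
    (k : ℕ) (s : Fin b → Fin n) (c : Bool) (st : State p) : State p :=
  let refresh : Prop := 1 ≤ k ∧ c = true
  let snap := if refresh then st.xprev else st.snap
  let Fsnap := if refresh then avg F st.xprev else st.Fsnap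
  let Ftilde := Fsnap + ((1 / (b : ℝ)) • ∑ j, F (s j) st.x - (1 / (b : ℝ)) • ∑ j, F (s j) snap)
  let Gtilde := (1 / lam) • (st.x - resolvent lam T (st.x - lam • Ftilde))
  let t := tSeq μ r k
  let y := ((t - 1) / t) • st.x + (1 / t) • st.z
  let xnext := y - etaSeq μ r β k • Gtilde
  { x := xnext
    xprev := st.x
    z := st.z + (μ / 2) • (xnext - y)
    snap := snap
    Fsnap := Fsnap
    fCalls := st.fCalls + (if refresh then n else 0) + 2 * b
    jCalls := st.jCalls + 1 }

/-- The state after `K` iterations, which holds `x^K`, for the given mini-batches `S k` and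
switches `c k`. -/
noncomputable def run {p n b : ℕ} (lam μ r β : ℝ)
    (F : Fin n → EuclideanSpace ℝ (Fin p) → EuclideanSpace ℝ (Fin p))
    (T : EuclideanSpace ℝ (Fin p) → Set (EuclideanSpace ℝ (Fin p)))
    (x0 : EuclideanSpace ℝ (Fin p)) (S : ℕ → Fin b → Fin n) (c : ℕ → Bool) : ℕ → State p
  | 0 => initState F x0
  | k + 1 => step lam μ r β F T k (S k) (c k) (run lam μ r β F T x0 S c k)

/-- The randomness of the algorithm: the sampled indices `S k j` are uniform on `Fin n`, the switch
`c k` holds with probability `q k` for `k ≥ 1`, and all these random variables are mutually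
independent. -/
structure IsSampling {Ω : Type*} [MeasurableSpace Ω] (P : Measure Ω) {n b : ℕ} (q : ℕ → ℝ)
    (S : ℕ → Fin b → Ω → Fin n) (c : ℕ → Ω → Bool) : Prop where
  measurable_S : ∀ k j, Measurable (S k j)
  measurable_c : ∀ k, Measurable (c k)
  uniform : ∀ k j i, P.real {w | S k j w = i} = 1 / (n : ℝ)
  bernoulli : ∀ k, 1 ≤ k → P.real {w | c k w = true} = q k
  indep : iIndep (fun i : (ℕ × Fin b) ⊕ ℕ => Sum.elim
    (fun a => MeasurableSpace.comap (S a.1 a.2) ⊤) (fun k => MeasurableSpace.comap (c k) ⊤) i) P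

end VFOSA

/-!
Let `g = G x^k` be the forward-backward residual at the iterate, `e` the error of the computed
residual, `s = x^k - z^k` and `t = t_k`.

*The residual.* By the finite-dimensional Minty theorem for co-hypomonotone operators
(`resolventSet_nonempty`), resolvents of `T` are defined everywhere. Compactness reduces that
theorem to finitely many points of the graph, for which the maximizer of a concave quadratic
function on the simplex gives the solution (`exists_forall_inner_sub_sub_nonpos`). The residual is
co-coercive with constant `betaBar`, with a surplus `Λ * meanSqDist F x y`
(`residual_cocoercive`), and `‖e‖` is at most the error of the estimator of `F x^k`
(`norm_forwardBackward_sub_le`).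

*The energy.* `energy` combines `‖g‖ ^ 2`, `⟨g, s⟩`, `‖s‖ ^ 2` and `‖z^k - x⋆‖ ^ 2`. The weight of
the last term is `1 / (μ * η_k)`; it decreases at the rate `1 / t ^ 2`, which pays for the inner
product of `e` with `z^{k+1} - x⋆`. The estimator of the residual is biased, so this product does
not vanish in the mean. The weight of `‖s‖ ^ 2` is the one for which the terms `⟨g, s⟩` cancel.
One iteration (`energy_step`) lowers the energy by `t (t - 1) Λ * meanSqDist F x^{k+1} x^k`, up to
`(5 β / (2 μ)) t (t - 1) ‖e‖ ^ 2`, and the energy dominates `(β / 2) (t - μ) ^ 2 ‖g‖ ^ 2`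
(`energy_ge`).

*The variance.* All random variables take finitely many values. By independence of the samples
and switches, the variance is at most `1 / b` times the mean square distance to the snapshot point,
which contracts by the factor `1 - p_k / 2` up to `2 / p_k` times the last step
(`IsSampling.integral_estimator_le`, `IsSampling.snapGap_succ_le`). The choice of `p_k` makes this
contraction beat the growth of the weights `t (t - 1)` (`switchProb_contraction`), and the choice of
`b` makes the energy pay for the rest, so the expected energy never exceeds `β * Psi0 ^ 2`
(`le_initial_of_variance_contraction`). Hence `(μ (k + r - 1)) ^ 2 * 𝔼 ‖G x^k‖ ^ 2 ≤ 2 * Psi0 ^ 2`,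
and `K = ⌊√2 * Psi0 / (μ * ε)⌋` iterations are enough.

*The cost.* The expected number of evaluations is `n + 2 b K + n ∑ p_k`, and the sum of the harmonic
part of `p_k` is at most a logarithm (`integral_fCalls_le`).
-/

namespace VFOSA

/-! ### Maximal co-hypomonotone operators and their resolvents -/

section Minty

variable {E : Type*} [NormedAddCommGroup E] [InnerProductSpace ℝ E]

/-- Finitely many balls with diameters `[q i, r i]` meet if the pairs `(q i, -r i)` are monotone. -/
theorem exists_forall_inner_sub_sub_nonpos {ι : Type*} [Fintype ι] (q r : ι → E)
    (h : ∀ i j, inner ℝ (q i - q j) (r i - r j) ≤ 0) :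
    ∃ v, ∀ i, inner ℝ (v - q i) (v - r i) ≤ 0 := by
  classical
  rcases isEmpty_or_nonempty ι with hι | hι
  · exact ⟨0, fun i => hι.elim i⟩
  set M : (ι → ℝ) → E := fun l => ∑ i, l i • ((1 / 2 : ℝ) • (q i + r i)) with hM
  set D : (ι → ℝ) → ℝ := fun l => ∑ i, l i * inner ℝ (q i) (r i) - ‖M l‖ ^ 2 with hD
  have hDc : Continuous D := by
    simp only [hD, hM]
    fun_prop
  have hne : (stdSimplex ℝ ι).Nonempty := ⟨_, single_mem_stdSimplex ℝ (Classical.arbitrary ι)⟩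
  obtain ⟨l, hl, hmax⟩ := (isCompact_stdSimplex ℝ ι).exists_isMaxOn hne hDc.continuousOn
  -- the weighted sum of the quadratic functions, with the square completed
  have key : ∀ k ∈ stdSimplex ℝ ι, ∀ v : E,
      ∑ i, k i * inner ℝ (v - q i) (v - r i) = ‖v - M k‖ ^ 2 + D k := by
    intro k hk v
    have e1 : ∀ i, k i * inner ℝ (v - q i) (v - r i)
        = k i * ‖v‖ ^ 2 - 2 * inner ℝ v (k i • ((1 / 2 : ℝ) • (q i + r i)))
          + k i * inner ℝ (q i) (r i) := by
      intro i
      simp only [inner_sub_left, inner_sub_right, inner_add_right, real_inner_smul_right,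
        real_inner_self_eq_norm_sq]
      rw [real_inner_comm v (q i)]
      ring
    rw [Finset.sum_congr rfl fun i _ => e1 i, Finset.sum_add_distrib, Finset.sum_sub_distrib,
      ← Finset.sum_mul, hk.2, ← Finset.mul_sum, ← inner_sum, norm_sub_sq_real]
    simp only [hD, hM]
    ring
  have hDl : D l ≤ 0 := by
    have h1 : 0 ≤ ∑ i, ∑ j, l i * l j * (-inner ℝ (q i - q j) (r i - r j)) :=
      Finset.sum_nonneg fun i _ => Finset.sum_nonneg fun j _ =>
        mul_nonneg (mul_nonneg (hl.1 i) (hl.1 j)) (by linarith [h i j])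
    have h2 : ∑ i, ∑ j, l i * l j * (-inner ℝ (q i - q j) (r i - r j))
        = 2 * inner ℝ (∑ i, l i • q i) (∑ i, l i • r i)
          - 2 * ∑ i, l i * inner ℝ (q i) (r i) := by
      have e : ∀ i j, l i * l j * (-inner ℝ (q i - q j) (r i - r j))
          = inner ℝ (l i • q i) (l j • r j) + inner ℝ (l j • q j) (l i • r i)
            - l j * (l i * inner ℝ (q i) (r i)) - l i * (l j * inner ℝ (q j) (r j)) := by
        intro i j
        simp only [inner_sub_left, inner_sub_right, real_inner_smul_left, real_inner_smul_right]
        ring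
      simp only [e, Finset.sum_sub_distrib, Finset.sum_add_distrib]
      rw [Finset.sum_comm (f := fun i j => inner ℝ (l j • q j) (l i • r i))]
      simp only [← inner_sum, ← sum_inner, ← Finset.sum_mul, ← Finset.mul_sum, hl.2]
      ring
    have h3 : M l = (1 / 2 : ℝ) • ((∑ i, l i • q i) + ∑ i, l i • r i) := by
      simp only [hM, smul_add, Finset.sum_add_distrib, Finset.smul_sum]
      congr 1 <;> exact Finset.sum_congr rfl fun i _ => smul_comm _ _ _
    have h4 : inner ℝ (∑ i, l i • q i) (∑ i, l i • r i) ≤ ‖M l‖ ^ 2 := by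
      rw [h3, norm_smul, mul_pow, norm_add_sq_real]
      have := sq_nonneg ‖(∑ i, l i • q i) - ∑ i, l i • r i‖
      rw [norm_sub_sq_real] at this
      norm_num
      linarith
    simp only [hD]
    linarith
  refine ⟨M l, fun i => ?_⟩
  -- moving from the maximizer towards a vertex does not increase `D`
  have hstep : ∀ ε : ℝ, 0 < ε → ε ≤ 1 →
      inner ℝ (M l - q i) (M l - r i) ≤ ε * ‖M l - (1 / 2 : ℝ) • (q i + r i)‖ ^ 2 := by
    intro ε hε hε1
    set k : ι → ℝ := (1 - ε) • l + ε • Pi.single i 1 with hk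
    have hkm : k ∈ stdSimplex ℝ ι :=
      convex_stdSimplex ℝ ι hl (single_mem_stdSimplex ℝ i) (by linarith) hε.le (by ring)
    have h1 : D k ≤ D l := hmax hkm
    have h2 := key k hkm (M l)
    have h3 := key l hl (M l)
    have h4 : ∑ j, k j * inner ℝ (M l - q j) (M l - r j)
        = (1 - ε) * ∑ j, l j * inner ℝ (M l - q j) (M l - r j)
          + ε * inner ℝ (M l - q i) (M l - r i) := by
      simp [hk, add_mul, Finset.sum_add_distrib, Finset.mul_sum, mul_assoc, Pi.single_apply]
    have h5 : M l - M k = ε • (M l - (1 / 2 : ℝ) • (q i + r i)) := by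
      have : M k = (1 - ε) • M l + ε • ((1 / 2 : ℝ) • (q i + r i)) := by
        simp only [hM, hk, Pi.add_apply, Pi.smul_apply, add_smul, Finset.sum_add_distrib,
          Finset.smul_sum, smul_eq_mul, mul_smul]
        congr 1
        rw [Finset.sum_eq_single i] <;> simp +contextual
      rw [this]
      module
    rw [h4, h5, norm_smul, mul_pow, Real.norm_eq_abs, sq_abs] at h2
    rw [h3, sub_self, norm_zero] at h2
    have h6 : ε * inner ℝ (M l - q i) (M l - r i)
        ≤ ε * (ε * ‖M l - (1 / 2 : ℝ) • (q i + r i)‖ ^ 2) := by nlinarith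
    exact le_of_mul_le_mul_left h6 hε
  by_contra hc
  push Not at hc
  set a := inner ℝ (M l - q i) (M l - r i)
  set B := ‖M l - (1 / 2 : ℝ) • (q i + r i)‖ ^ 2
  have hB : 0 ≤ B := by positivity
  have h7 := hstep (a / (a + B + a)) (by positivity)
    ((div_le_one (by positivity)).2 (by linarith))
  rw [div_mul_eq_mul_div, le_div_iff₀ (by positivity)] at h7
  nlinarith [mul_pos hc hc]

end Minty

variable {p : ℕ} {ρ lam : ℝ}
  {T : EuclideanSpace ℝ (Fin p) → Set (EuclideanSpace ℝ (Fin p))}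

/-- Minty's theorem. A point of the resolvent corresponds to a vector `v` that lies in one ball for
each point of the graph; the balls are compact, and any finitely many of them meet. -/
theorem resolventSet_nonempty (hT : MaxCoHypomonotone ρ T) (hlam : ρ < lam)
    (u : EuclideanSpace ℝ (Fin p)) : (resolventSet lam T u).Nonempty := by
  set γ := lam - ρ with hγ
  have hγ0 : 0 < γ := by linarith
  let Gr := {a : EuclideanSpace ℝ (Fin p) × EuclideanSpace ℝ (Fin p) // a.2 ∈ T a.1}
  let q : Gr → EuclideanSpace ℝ (Fin p) := fun a => a.1.2
  let r : Gr → EuclideanSpace ℝ (Fin p) := fun a => (1 / γ) • (u - (a.1.1 + ρ • a.1.2))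
  have hmono : ∀ a b : Gr, inner ℝ (q a - q b) (r a - r b) ≤ 0 := by
    intro a b
    have h := hT.1 a.1.1 b.1.1 a.1.2 b.1.2 a.2 b.2
    have e : r a - r b = (-(1 / γ)) • ((a.1.1 - b.1.1) + ρ • (a.1.2 - b.1.2)) := by
      simp only [r]; module
    rw [e, real_inner_smul_right, inner_add_right, real_inner_smul_right,
      real_inner_self_eq_norm_sq]
    have : 0 ≤ 1 / γ := by positivity
    simp only [q]
    nlinarith
  obtain ⟨v, hv⟩ : ∃ v, ∀ a : Gr, inner ℝ (v - q a) (v - r a) ≤ 0 := by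
    rcases isEmpty_or_nonempty Gr with hG | ⟨⟨a0⟩⟩
    · exact ⟨0, fun a => hG.elim a⟩
    let B : Gr → Set (EuclideanSpace ℝ (Fin p)) := fun a => {v | inner ℝ (v - q a) (v - r a) ≤ 0}
    have hcl : ∀ a, IsClosed (B a) := fun a =>
      isClosed_le (by fun_prop) continuous_const
    have hcomp : IsCompact (B a0) := by
      refine Metric.isCompact_of_isClosed_isBounded (hcl a0)
        ((Metric.isBounded_closedBall (x := q a0) (r := ‖q a0 - r a0‖)).subset ?_)
      intro v hv
      have hv' : inner ℝ (v - q a0) (v - r a0) ≤ 0 := hv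
      rw [Metric.mem_closedBall, dist_eq_norm]
      have e : v - r a0 = (v - q a0) + (q a0 - r a0) := by abel
      rw [e, inner_add_right, real_inner_self_eq_norm_sq] at hv'
      have h2 := neg_le_of_abs_le (abs_real_inner_le_norm (v - q a0) (q a0 - r a0))
      by_contra hc
      push Not at hc
      nlinarith [norm_nonneg (v - q a0), norm_nonneg (q a0 - r a0)]
    classical
    have := hcomp.inter_iInter_nonempty B hcl (fun s => by
      obtain ⟨v, hv⟩ := exists_forall_inner_sub_sub_nonpos
        (fun a : ↥(insert a0 s) => q a) (fun a => r a) (fun a b => hmono a b)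
      exact ⟨v, hv ⟨a0, Finset.mem_insert_self _ _⟩,
        Set.mem_iInter₂.2 fun a ha => hv ⟨a, Finset.mem_insert_of_mem ha⟩⟩)
    obtain ⟨v, -, hv⟩ := this
    exact ⟨v, fun a => Set.mem_iInter.1 hv a⟩
  refine ⟨u - lam • v, v, ?_, by module⟩
  -- adjoining the new point to the graph keeps it co-hypomonotone
  have hnew : ∀ y w, w ∈ T y → -ρ * ‖v - w‖ ^ 2 ≤ inner ℝ (v - w) (u - lam • v - y) := by
    intro y w hw
    have h := hv ⟨(y, w), hw⟩
    simp only [q, r] at h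
    have e : u - lam • v - y
        = (-γ) • (v - (1 / γ) • (u - (y + ρ • w))) - ρ • (v - w) := by
      rw [smul_sub, smul_smul, neg_mul, mul_one_div_cancel hγ0.ne', hγ]
      module
    rw [e, inner_sub_right, real_inner_smul_right, real_inner_smul_right,
      real_inner_self_eq_norm_sq]
    nlinarith
  refine hT.2 (fun y => {w | w ∈ T y ∨ (y = u - lam • v ∧ w = v)}) ?_
    (fun y w hw => Or.inl hw) _ (Or.inr ⟨rfl, rfl⟩)
  rintro x y a b (ha | ⟨rfl, rfl⟩) (hb | ⟨rfl, rfl⟩)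
  · exact hT.1 _ _ _ _ ha hb
  · have := hnew _ _ ha
    rw [← neg_sub a, ← neg_sub x, norm_neg, inner_neg_neg] at this
    exact this
  · exact hnew _ _ hb
  · simp

/-- The value `g` of the forward-backward residual at `x`, computed with a vector `f` in place of
`F x`, is `f` plus an element of `T`. -/
theorem forwardBackward_sub_mem (hT : MaxCoHypomonotone ρ T) (h0 : 0 < lam) (hlam : ρ < lam)
    (x f : EuclideanSpace ℝ (Fin p)) :
    (1 / lam) • (x - resolvent lam T (x - lam • f)) - f
      ∈ T (x - lam • ((1 / lam) • (x - resolvent lam T (x - lam • f)))) := by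
  have hne := resolventSet_nonempty hT hlam (x - lam • f)
  have hmem : resolvent lam T (x - lam • f) ∈ resolventSet lam T (x - lam • f) := by
    rw [resolvent, dif_pos hne]
    exact hne.some_mem
  obtain ⟨v, hv, hw⟩ := hmem
  set w := resolvent lam T (x - lam • f)
  have e1 : x - lam • ((1 / lam) • (x - w)) = w := by
    rw [smul_smul, mul_one_div_cancel h0.ne']
    module
  have e2 : (1 / lam) • (x - w) - f = v := by
    have : x - w = lam • (v + f) := by
      rw [smul_add, ← sub_eq_zero]
      rw [← sub_eq_zero] at hw
      rw [← neg_eq_zero, ← hw]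
      abel
    rw [this, smul_smul, one_div_mul_cancel h0.ne', one_smul, add_sub_cancel_right]
  rwa [e1, e2]

/-- The computed residual is a nonexpansive function of the vector `f` used in place of `F x`. -/
theorem norm_forwardBackward_sub_le (hT : MaxCoHypomonotone ρ T) (h0 : 0 < lam) (hρ : 0 ≤ ρ)
    (hlam : 2 * ρ ≤ lam) (x f f' : EuclideanSpace ℝ (Fin p)) :
    ‖(1 / lam) • (x - resolvent lam T (x - lam • f))
      - (1 / lam) • (x - resolvent lam T (x - lam • f'))‖ ≤ ‖f - f'‖ := by
  have h1 := forwardBackward_sub_mem hT h0 (by linarith) x f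
  have h2 := forwardBackward_sub_mem hT h0 (by linarith) x f'
  set g := (1 / lam) • (x - resolvent lam T (x - lam • f))
  set g' := (1 / lam) • (x - resolvent lam T (x - lam • f'))
  have h := hT.1 _ _ _ _ h1 h2
  rw [show x - lam • g - (x - lam • g') = (-lam) • (g - g') by module,
    show g - f - (g' - f') = (g - g') - (f - f') by abel, real_inner_smul_right, inner_sub_left,
    real_inner_self_eq_norm_sq, norm_sub_sq_real, real_inner_comm (g - g') (f - f')] at h
  have hcs := real_inner_le_norm (g - g') (f - f')
  by_contra hc
  push Not at hc
  have hf := norm_nonneg (f - f')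
  have h3 : (lam - 2 * ρ) * inner ℝ (g - g') (f - f')
      ≤ (lam - 2 * ρ) * (‖g - g'‖ * ‖f - f'‖) :=
    mul_le_mul_of_nonneg_left hcs (by linarith)
  have h4 : 0 < (lam - ρ) * (‖g - g'‖ * (‖g - g'‖ - ‖f - f'‖)) :=
    mul_pos (by linarith) (mul_pos (by linarith) (by linarith))
  have h5 : 0 ≤ ρ * (‖f - f'‖ * (‖g - g'‖ - ‖f - f'‖)) :=
    mul_nonneg hρ (mul_nonneg hf (by linarith))
  nlinarith

theorem residual_eq_zero (hT : MaxCoHypomonotone ρ T) (h0 : 0 < lam) (hlam : ρ < lam)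
    {F : EuclideanSpace ℝ (Fin p) → EuclideanSpace ℝ (Fin p)} {xstar : EuclideanSpace ℝ (Fin p)}
    (hx : xstar ∈ zer F T) : residual lam F T xstar = 0 := by
  obtain ⟨v, hv, hz⟩ := hx
  have h1 := forwardBackward_sub_mem hT h0 hlam xstar (F xstar)
  change residual lam F T xstar - F xstar ∈ T (xstar - lam • residual lam F T xstar) at h1
  set g := residual lam F T xstar
  have h := hT.1 _ _ _ _ h1 hv
  rw [show xstar - lam • g - xstar = (-lam) • g by module,
    show g - F xstar - v = g by rw [sub_sub, hz, sub_zero],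
    real_inner_smul_right, real_inner_self_eq_norm_sq] at h
  have : ‖g‖ ^ 2 ≤ 0 := by
    by_contra hc
    push Not at hc
    nlinarith
  simpa using le_antisymm this (by positivity)

/-- The mean `(1 / n) * ∑ i, ‖F_i x - F_i y‖ ^ 2`. -/
noncomputable def meanSqDist {n : ℕ}
    (F : Fin n → EuclideanSpace ℝ (Fin p) → EuclideanSpace ℝ (Fin p))
    (x y : EuclideanSpace ℝ (Fin p)) : ℝ :=
  1 / (n : ℝ) * ∑ i, ‖F i x - F i y‖ ^ 2

section FiniteSum

variable {n : ℕ} {F : Fin n → EuclideanSpace ℝ (Fin p) → EuclideanSpace ℝ (Fin p)}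

theorem meanSqDist_nonneg (x y : EuclideanSpace ℝ (Fin p)) : 0 ≤ meanSqDist F x y :=
  mul_nonneg (by positivity) (Finset.sum_nonneg fun _ _ => by positivity)

theorem meanSqDist_self (x : EuclideanSpace ℝ (Fin p)) : meanSqDist F x x = 0 := by
  simp [meanSqDist]

theorem norm_avg_sub_sq_le (x y : EuclideanSpace ℝ (Fin p)) :
    ‖avg F x - avg F y‖ ^ 2 ≤ meanSqDist F x y := by
  rcases Nat.eq_zero_or_pos n with rfl | hn
  · simp [avg, meanSqDist]
  have hn' : (0 : ℝ) < n := by exact_mod_cast hn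
  have e : avg F x - avg F y = (1 / (n : ℝ)) • ∑ i, (F i x - F i y) := by
    simp only [avg, Finset.sum_sub_distrib, smul_sub]
  rw [e, norm_smul, mul_pow, meanSqDist, Real.norm_eq_abs, sq_abs]
  have h1 : ‖∑ i, (F i x - F i y)‖ ^ 2 ≤ (∑ i, ‖F i x - F i y‖) ^ 2 := by
    gcongr
    exact norm_sum_le _ _
  have h2 := sq_sum_le_card_mul_sum_sq (s := Finset.univ) (f := fun i => ‖F i x - F i y‖)
  simp only [Finset.card_univ, Fintype.card_fin] at h2
  calc (1 / (n : ℝ)) ^ 2 * ‖∑ i, (F i x - F i y)‖ ^ 2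
      ≤ (1 / (n : ℝ)) ^ 2 * (n * ∑ i, ‖F i x - F i y‖ ^ 2) := by gcongr; exact h1.trans h2
    _ = _ := by field_simp

/-- Average co-coercivity of `F` and co-hypomonotonicity of `T` make the residual
`betaBar`-co-coercive; the gap between `L` and `Lhat` leaves over a multiple of `meanSqDist`. -/
theorem residual_cocoercive {L Lhat : ℝ} (hF : AverageCocoercive L F)
    (hT : MaxCoHypomonotone ρ T) (hL : 0 < L) (hLL : L < Lhat) (hρ : Lhat * ρ < 1)
    (h0 : 0 < lam) (hlam : ρ < lam) (x y : EuclideanSpace ℝ (Fin p)) :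
    betaBar Lhat ρ lam * ‖residual lam (avg F) T x - residual lam (avg F) T y‖ ^ 2
        + bigLambda L Lhat * meanSqDist F x y
      ≤ inner ℝ (residual lam (avg F) T x - residual lam (avg F) T y) (x - y) := by
  have h1 := forwardBackward_sub_mem hT h0 hlam x (avg F x)
  have h2 := forwardBackward_sub_mem hT h0 hlam y (avg F y)
  change residual lam (avg F) T x - avg F x ∈ T (x - lam • residual lam (avg F) T x) at h1
  change residual lam (avg F) T y - avg F y ∈ T (y - lam • residual lam (avg F) T y) at h2
  have h3 := norm_avg_sub_sq_le (F := F) x y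
  have h4 := hF x y
  set g := residual lam (avg F) T x
  set g' := residual lam (avg F) T y
  have hLh : 0 < Lhat := hL.trans hLL
  have e1 : 1 / ((n : ℝ) * L) * ∑ i, ‖F i x - F i y‖ ^ 2
      = (bigLambda L Lhat + 1 / Lhat) * meanSqDist F x y := by
    rw [bigLambda, meanSqDist]
    have : (Lhat - L) / (L * Lhat) + 1 / Lhat = 1 / L := by field_simp; ring
    rw [this, one_div, mul_inv]
    ring
  rw [e1] at h4
  have h := hT.1 _ _ _ _ h1 h2
  set f := avg F x - avg F y
  generalize hd : x - y = d at h4 ⊢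
  rw [show x - lam • g - (y - lam • g') = d - lam • (g - g') by rw [← hd]; module,
    show g - avg F x - (g' - avg F y) = (g - g') - f by simp only [f]; abel,
    inner_sub_left, inner_sub_right, inner_sub_right, real_inner_smul_right,
    real_inner_smul_right,
    real_inner_self_eq_norm_sq, norm_sub_sq_real, real_inner_comm (g - g') f] at h
  have hκ : 0 < 1 / Lhat - ρ := by
    rw [sub_pos, lt_div_iff₀ hLh]; linarith
  set κ := 1 / Lhat - ρ with hκd
  have e2 : betaBar Lhat ρ lam = lam - ρ - (lam - 2 * ρ) ^ 2 / (4 * κ) := by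
    have : κ = (1 - Lhat * ρ) / Lhat := by rw [hκd]; field_simp
    have h' : 1 - Lhat * ρ ≠ 0 := by linarith
    have h'' : 1 - ρ * Lhat ≠ 0 := by linarith
    rw [betaBar, this]
    field_simp
    ring
  have h5 : 0 ≤ κ * ‖f‖ ^ 2 - (lam - 2 * ρ) * inner ℝ (g - g') f
      + (lam - 2 * ρ) ^ 2 / (4 * κ) * ‖g - g'‖ ^ 2 := by
    have := sq_nonneg ‖κ • f - ((lam - 2 * ρ) / 2) • (g - g')‖
    rw [norm_sub_sq_real, norm_smul, norm_smul, real_inner_smul_left, real_inner_smul_right,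
      mul_pow, mul_pow, Real.norm_eq_abs, Real.norm_eq_abs, sq_abs, sq_abs,
      real_inner_comm (g - g') f] at this
    have e3 : κ * ‖f‖ ^ 2 - (lam - 2 * ρ) * inner ℝ (g - g') f
      + (lam - 2 * ρ) ^ 2 / (4 * κ) * ‖g - g'‖ ^ 2 = (κ ^ 2 * ‖f‖ ^ 2
        - 2 * (κ * ((lam - 2 * ρ) / 2 * inner ℝ (g - g') f))
        + ((lam - 2 * ρ) / 2) ^ 2 * ‖g - g'‖ ^ 2) / κ := by
      field_simp
      ring
    rw [e3]
    positivity
  have h6 : 1 / Lhat * ‖f‖ ^ 2 ≤ 1 / Lhat * meanSqDist F x y := by gcongr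
  rw [e2]
  have h7 : 1 / Lhat * ‖f‖ ^ 2 = κ * ‖f‖ ^ 2 + ρ * ‖f‖ ^ 2 := by rw [hκd]; ring
  linarith

end FiniteSum

/-! ### Decrease of the energy in one step -/

section Energy

variable {E : Type*} [NormedAddCommGroup E] [InnerProductSpace ℝ E]

/-- The energy at time `t = t_k`, where `g` is the residual at `x^k`, `s = x^k - z^k` and
`u = z^k - x⋆`. -/
noncomputable def energy (μ β t : ℝ) (g s u : E) : ℝ :=
  β * (t - μ) * (t - μ - 1) * ‖g‖ ^ 2 + (t - μ) * inner ℝ g s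
    + μ * t * (t - μ / 2) / (4 * β * (1 - μ / 2) * (t - 1) ^ 2) * ‖s‖ ^ 2
    + (t - μ / 2) / (2 * μ * β * (t - 1)) * ‖u‖ ^ 2

/-- Young's inequality as the nonnegativity of a quadratic form. -/
theorem add_inner_add_nonneg {a b c : ℝ} (ha : 0 < a) (hc : b ^ 2 / (4 * a) ≤ c) (v w : E) :
    0 ≤ a * ‖v‖ ^ 2 + b * inner ℝ v w + c * ‖w‖ ^ 2 := by
  have h := sq_nonneg ‖a • v + (b / 2) • w‖
  rw [norm_add_sq_real, norm_smul, norm_smul, real_inner_smul_left, real_inner_smul_right,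
    mul_pow, mul_pow, Real.norm_eq_abs, Real.norm_eq_abs, sq_abs, sq_abs] at h
  have h2 : b ^ 2 / (4 * a) * ‖w‖ ^ 2 ≤ c * ‖w‖ ^ 2 := by gcongr
  have h3 : a * ‖v‖ ^ 2 + b * inner ℝ v w + b ^ 2 / (4 * a) * ‖w‖ ^ 2
      = (a ^ 2 * ‖v‖ ^ 2 + 2 * (a * (b / 2 * inner ℝ v w)) + (b / 2) ^ 2 * ‖w‖ ^ 2) / a := by
    field_simp
    ring
  have h4 : 0 ≤ (a ^ 2 * ‖v‖ ^ 2 + 2 * (a * (b / 2 * inner ℝ v w))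
      + (b / 2) ^ 2 * ‖w‖ ^ 2) / a := by positivity
  linarith

/-- The coefficient of `‖g‖ ^ 2` left over after the telescoping is at least `μ * β`. -/
theorem residual_coeff_ge {μ β bbar t : ℝ} (hμ : 0 < μ) (hμ' : μ < 2 / 3) (hβ : 0 < β)
    (hb : (2 + μ) * β ≤ (2 - μ) * bbar) (ht : 1 + 5 * μ < t) :
    μ * β ≤ β * (t - μ) * (t - μ - 1) + β * t * (t - 1)
      - t * (t - 1) * (2 * β * (t - 1) / (t - μ / 2)) + bbar
      - μ / 4 * (2 * β * (t - 1) / (t - μ / 2))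
      - μ * t / (2 * (t - 1)) * (1 - μ / 2) * (2 * β * (t - 1) / (t - μ / 2)) := by
  have h1 : 0 < t - μ / 2 := by linarith
  have h2 : 0 < t - 1 := by linarith
  have hb' : (1 + μ) * β ≤ bbar := by nlinarith [mul_pos hμ hβ]
  have h3 : t * 2 - μ ≠ 0 := by linarith
  have e : μ * t / (2 * (t - 1)) * (1 - μ / 2) * (2 * β * (t - 1) / (t - μ / 2))
      = μ * t * (1 - μ / 2) * β / (t - μ / 2) := by field_simp
  rw [e]
  have key : 0 ≤ ((t - μ) * (t - μ - 1) + t * (t - 1) + 1) * (t - μ / 2)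
      - 2 * t * (t - 1) ^ 2 - μ / 2 * (t - 1) - μ * t * (1 - μ / 2) := by
    have e : ((t - μ) * (t - μ - 1) + t * (t - 1) + 1) * (t - μ / 2)
        - 2 * t * (t - 1) ^ 2 - μ / 2 * (t - 1) - μ * t * (1 - μ / 2)
        = t * ((2 - 3 * μ) * t + 5 / 2 * μ ^ 2 + μ / 2 - 1) - (μ ^ 3 + μ ^ 2) / 2 := by ring
    have k1 : 0 ≤ (2 - 3 * μ) * (t - (1 + 5 * μ)) := mul_nonneg (by linarith) (by linarith)
    have k2 : 0 ≤ μ * (2 / 3 - μ) := mul_nonneg hμ.le (by linarith)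
    have k3 : 4 / 9 ≤ (2 - 3 * μ) * t + 5 / 2 * μ ^ 2 + μ / 2 - 1 := by nlinarith
    have k4 : μ ^ 3 + μ ^ 2 ≤ 8 / 9 := by nlinarith
    rw [e]
    nlinarith
  have e2 : β * (t - μ) * (t - μ - 1) + β * t * (t - 1)
      - t * (t - 1) * (2 * β * (t - 1) / (t - μ / 2)) + bbar
      - μ / 4 * (2 * β * (t - 1) / (t - μ / 2))
      - μ * t * (1 - μ / 2) * β / (t - μ / 2) - μ * β
      = β / (t - μ / 2) * (((t - μ) * (t - μ - 1) + t * (t - 1) + 1) * (t - μ / 2)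
      - 2 * t * (t - 1) ^ 2 - μ / 2 * (t - 1) - μ * t * (1 - μ / 2)) + (bbar - (1 + μ) * β) := by
    field_simp
    ring
  have : 0 ≤ β / (t - μ / 2) * (((t - μ) * (t - μ - 1) + t * (t - 1) + 1) * (t - μ / 2)
      - 2 * t * (t - 1) ^ 2 - μ / 2 * (t - 1) - μ * t * (1 - μ / 2)) := by positivity
  linarith

/-- The total coefficient of `‖e‖ ^ 2` that the Young inequalities in `energy_step` produce. -/
theorem noise_coeff_le {μ β t η X : ℝ} (hμ : 0 < μ) (hμ' : μ < 2 / 3) (hβ : 0 < β)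
    (ht : 1 + 5 * μ < t) (hη : η = 2 * β * (t - 1) / (t - μ / 2))
    (hX : X = t * (t - 1) * (2 * β - η) - (μ * (1 - μ / 2) * (2 * β * t / (t - μ / 2)))) :
    t * (t - 1) * ((2 * β) ^ 2 / (4 * (2 * μ * β / (2 - μ))))
      + 1 ^ 2 / (4 * ((1 - μ / 2) / (2 * β * (t - 1) * t)))
      + μ ^ 2 / (4 * (μ / (4 * β * (t - 1)))) + X ^ 2 / (4 * (μ * β))
      + ((μ * (1 - μ / 2) * (2 * β * t / (t - μ / 2))) / 2 - μ / 4 * η)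
      ≤ 5 * β / (2 * μ) * (t * (t - 1)) := by
  have ht0 : 0 < t := by linarith
  have hd : 0 < t - 1 := by linarith
  have hw : 0 < t - μ / 2 := by linarith
  have hν : 0 < 1 - μ / 2 := by linarith
  have hw2 : t * 2 - μ ≠ 0 := by linarith
  have hw3 : 2 * t - μ ≠ 0 := by linarith
  have hν2 : 2 - μ ≠ 0 := by linarith
  set B := β / μ * (t * (t - 1)) with hB
  have hB0 : 0 < B := by positivity
  have n1 : t * (t - 1) * ((2 * β) ^ 2 / (4 * (2 * μ * β / (2 - μ)))) = B * (1 - μ / 2) := by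
    rw [hB]; field_simp; ring
  have n2 : 1 ^ 2 / (4 * ((1 - μ / 2) / (2 * β * (t - 1) * t))) ≤ B * (3 / 4 * μ) := by
    have : 1 ^ 2 / (4 * ((1 - μ / 2) / (2 * β * (t - 1) * t)))
      = B * (μ * (1 / (2 * (1 - μ / 2)))) := by rw [hB]; field_simp; norm_num
    rw [this]
    have : 1 / (2 * (1 - μ / 2)) ≤ 3 / 4 := by rw [div_le_iff₀ (by linarith)]; linarith
    have := mul_le_mul_of_nonneg_left this hμ.le
    exact mul_le_mul_of_nonneg_left (by linarith) hB0.le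
  have n3 : μ ^ 2 / (4 * (μ / (4 * β * (t - 1)))) = B * (μ ^ 2 / t) := by
    rw [hB]; field_simp
  have n4 : X ^ 2 / (4 * (μ * β)) ≤ B := by
    have hXe : X = 2 * β * (1 - μ / 2) * (t * (t - 1 - μ) / (t - μ / 2)) := by
      rw [hX, hη]; field_simp; ring
    have e1 : X ^ 2 / (4 * (μ * β))
        = B * ((1 - μ / 2) ^ 2
          * (t * (t - 1 - μ) / (t - μ / 2) ^ 2 * ((t - 1 - μ) / (t - 1)))) := by
      rw [hXe, hB]; field_simp; ring
    have k1 : t * (t - 1 - μ) / (t - μ / 2) ^ 2 ≤ 1 := by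
      rw [div_le_one (by positivity)]; nlinarith
    have k2 : (t - 1 - μ) / (t - 1) ≤ 1 := by
      rw [div_le_one hd]; linarith
    have k3 : 0 ≤ (t - 1 - μ) / (t - 1) := div_nonneg (by linarith) hd.le
    have k4 : (1 - μ / 2) ^ 2 ≤ 1 := pow_le_one₀ hν.le (by linarith)
    have k5 : 0 ≤ t * (t - 1 - μ) / (t - μ / 2) ^ 2 :=
      div_nonneg (mul_nonneg ht0.le (by linarith)) (by positivity)
    rw [e1]
    exact mul_le_of_le_one_right hB0.le
      (mul_le_one₀ k4 (mul_nonneg k5 k3) (mul_le_one₀ k1 k3 k2))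
  have n5 : (μ * (1 - μ / 2) * (2 * β * t / (t - μ / 2))) / 2 - μ / 4 * η ≤ B * (1 / 5) := by
    have e1 : (μ * (1 - μ / 2) * (2 * β * t / (t - μ / 2))) / 2 - μ / 4 * η
          = B * (μ ^ 2 / (t * (t - 1))
        * ((t * (1 - μ) + 1) / (2 * (t - μ / 2)))) := by
      rw [hη, hB]; field_simp; ring
    have k1 : (t * (1 - μ) + 1) / (2 * (t - μ / 2)) ≤ 1 := by
      rw [div_le_one (by positivity)]; nlinarith
    have k2 : μ ^ 2 / (t * (t - 1)) ≤ 1 / 5 := by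
      rw [div_le_iff₀ (by positivity)]
      nlinarith [mul_pos hμ hd]
    have k3 : 0 ≤ μ ^ 2 / (t * (t - 1)) := by positivity
    rw [e1]
    refine mul_le_mul_of_nonneg_left ?_ hB0.le
    exact (mul_le_of_le_one_right k3 k1).trans k2
  have n6 : μ ^ 2 / t ≤ 1 / 5 * μ := by
    rw [div_le_iff₀ ht0]; nlinarith
  have n7 : 5 * β / (2 * μ) * (t * (t - 1)) = B * (5 / 2) := by rw [hB]; field_simp
  rw [n1, n3, n7]
  have n8 : B * (μ ^ 2 / t) ≤ B * (1 / 5 * μ) := mul_le_mul_of_nonneg_left n6 hB0.le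
  nlinarith

/-- One iteration with the error `e` in the residual `g`. The terms in `⟨g, s⟩` and `⟨g, g' - g⟩`
cancel; each of `g' - g`, `u`, `s` and `g` keeps a multiple of its square, which absorbs its inner
product with `e`. Here `bbar` is the co-coercivity constant of the residual and `S` the surplus in
the co-coercivity inequality. -/
theorem energy_step {μ β bbar t η S : ℝ} (hμ : 0 < μ) (hμ' : μ < 2 / 3) (hβ : 0 < β)
    (hb : (2 + μ) * β ≤ (2 - μ) * bbar) (ht : 1 + 5 * μ < t)
    (hη : η = 2 * β * (t - 1) / (t - μ / 2)) {g g' e x x' z z' xs : E}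
    (hx : x' = x - (1 / t) • (x - z) - η • (g + e)) (hz : z' = z - (μ / 2 * η) • (g + e))
    (h1 : bbar * ‖g' - g‖ ^ 2 + S ≤ inner ℝ (g' - g) (x' - x))
    (h2 : bbar * ‖g‖ ^ 2 ≤ inner ℝ g (x - xs)) :
    energy μ β (t + μ) g' (x' - z') (z' - xs) + t * (t - 1) * S
      ≤ energy μ β t g (x - z) (z - xs) + 5 * β / (2 * μ) * (t * (t - 1)) * ‖e‖ ^ 2 := by
  have ht0 : 0 < t := by linarith
  have hd : 0 < t - 1 := by linarith
  have hw : 0 < t - μ / 2 := by linarith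
  have hν : 0 < 1 - μ / 2 := by linarith
  have hw2 : t * 2 - μ ≠ 0 := by linarith
  have hw3 : 2 * t - μ ≠ 0 := by linarith
  have hν2 : 2 - μ ≠ 0 := by linarith
  have hη0 : 0 < η := by rw [hη]; positivity
  have hηe : η * (t - μ / 2) = 2 * β * (t - 1) := by rw [hη]; field_simp
  -- all vectors are expressed by `g`, `e`, `h = g' - g`, `s = x - z` and `u = z' - xs`
  obtain ⟨h, rfl⟩ : ∃ h, g' = g + h := ⟨g' - g, by abel⟩
  obtain ⟨s, rfl⟩ : ∃ s, x = z + s := ⟨x - z, by abel⟩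
  obtain ⟨u, hu⟩ : ∃ u, z' - xs = u := ⟨_, rfl⟩
  have ez : z - xs = u + (μ / 2 * η) • (g + e) := by rw [← hu, hz]; abel
  have exs : z + s - xs = s + u + (μ / 2 * η) • (g + e) := by
    rw [show z + s - xs = s + (z - xs) by abel, ez]; abel
  have exx : x' - (z + s) = (-(1 / t)) • s - η • (g + e) := by rw [hx]; module
  have es : x' - z' = ((t - 1) / t) • s - ((1 - μ / 2) * η) • (g + e) := by
    rw [hx, hz, sub_div, div_self ht0.ne']; module
  rw [exx, add_sub_cancel_left] at h1
  rw [exs] at h2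
  rw [hu, es, ez, add_sub_cancel_left, energy, energy]
  -- the weights of `‖s‖ ^ 2` and `‖u‖ ^ 2` decrease along the iteration
  set A := μ * t * (t - μ / 2) / (4 * β * (1 - μ / 2) * (t - 1) ^ 2) with hA
  set c := (t - μ / 2) / (2 * μ * β * (t - 1)) with hc
  set A' := μ * (t + μ) * (t + μ - μ / 2) / (4 * β * (1 - μ / 2) * (t + μ - 1) ^ 2) with hA'
  set c' := (t + μ - μ / 2) / (2 * μ * β * (t + μ - 1)) with hc'
  have hAη : A * (2 * (t - 1) * (1 - μ / 2) * η) = μ * t := by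
    rw [hA, hη]; field_simp; norm_num
  have hcη : c * (μ * η) = 1 := by
    rw [hc, hη]; field_simp
  have hd' : 0 < t + μ - 1 := by linarith
  have hAA : A' ≤ A := by
    have e1 : ∀ v : ℝ, v - 1 ≠ 0 → μ * v * (v - μ / 2) / (4 * β * (1 - μ / 2) * (v - 1) ^ 2)
        = μ / (4 * β * (1 - μ / 2)) * ((1 + 1 / (v - 1)) * (1 + (1 - μ / 2) / (v - 1))) := by
      intro v hv
      field_simp
      ring
    rw [hA, hA', e1 _ hd.ne', e1 _ hd'.ne']
    have : t - 1 ≤ t + μ - 1 := by linarith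
    gcongr
  have hcc : (1 - μ / 2) / (2 * β * (t - 1) * t) ≤ c - c' := by
    have e1 : c - c' = (1 - μ / 2) / (2 * β * (t - 1) * (t + μ - 1)) := by
      rw [hc, hc']; field_simp; ring
    rw [e1]
    gcongr
    linarith
  have hAd : μ / (4 * β * (t - 1)) ≤ A * (1 - ((t - 1) / t) ^ 2) := by
    have e1 : A * (1 - ((t - 1) / t) ^ 2)
        = μ / (4 * β * (t - 1)) * ((2 * t - 1) / t * ((t - μ / 2) / (t - 1)) / (1 - μ / 2)) := by
      rw [hA]; field_simp; ring
    rw [e1]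
    refine le_mul_of_one_le_right (by positivity) ?_
    rw [one_le_div hν]
    have k1 : 1 ≤ (2 * t - 1) / t := by rw [one_le_div ht0]; linarith
    have k2 : 1 ≤ (t - μ / 2) / (t - 1) := by rw [one_le_div hd]; linarith
    nlinarith
  have hgg := residual_coeff_ge hμ hμ' hβ hb ht
  rw [← hη, show μ * t / (2 * (t - 1)) * (1 - μ / 2) * η = μ * t / (t - 1) * (1 - μ / 2) * η / 2 by
    field_simp] at hgg
  set W := μ * t / (t - 1) * (1 - μ / 2) * η with hW
  have hWe : W = μ * (1 - μ / 2) * (2 * β * t / (t - μ / 2)) := by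
    rw [hW, hη]; field_simp
  have hκ : 2 * μ * β / (2 - μ) ≤ bbar - β := by
    rw [div_le_iff₀ (by linarith)]; linarith
  set κ := 2 * μ * β / (2 - μ) with hκd
  have hκ0 : 0 < κ := by
    have : 0 < 2 - μ := by linarith
    rw [hκd]; positivity
  set X := t * (t - 1) * (2 * β - η) - W with hX
  have Y1 := add_inner_add_nonneg (b := 2 * β) hκ0 le_rfl h e
  have Y2 := add_inner_add_nonneg (a := (1 - μ / 2) / (2 * β * (t - 1) * t)) (b := 1)
    (by positivity) le_rfl u e
  have Y3 := add_inner_add_nonneg (a := μ / (4 * β * (t - 1))) (b := μ)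
    (by positivity) le_rfl s e
  have Y4 := add_inner_add_nonneg (a := μ * β) (b := X) (by positivity) le_rfl g e
  have hN := noise_coeff_le hμ hμ' hβ ht hη (hWe ▸ hX)
  rw [← hWe, ← hκd] at hN
  set j := (t - 1) / t with hj
  have htj : t * j = t - 1 := by rw [hj]; field_simp
  have hti : t * (1 / t) = 1 := by field_simp
  have hAj : A * (2 * j * ((1 - μ / 2) * η)) = μ := by
    have : t * (A * (2 * j * ((1 - μ / 2) * η))) = t * μ := by
      linear_combination hAη + A * 2 * (1 - μ / 2) * η * htj
    exact mul_left_cancel₀ ht0.ne' this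
  have hAκ : A * ((1 - μ / 2) * η) ^ 2 = W / 2 := by
    have : (t - 1) * (A * ((1 - μ / 2) * η) ^ 2) = (t - 1) * (W / 2) := by
      have hWd : (t - 1) * W = μ * t * ((1 - μ / 2) * η) := by rw [hW]; field_simp
      linear_combination (1 - μ / 2) * η / 2 * hAη - hWd / 2
    exact mul_left_cancel₀ hd.ne' this
  have hAs := mul_le_mul_of_nonneg_right hAA (sq_nonneg ‖j • s - ((1 - μ / 2) * η) • (g + e)‖)
  have hAs2 := mul_le_mul_of_nonneg_right hAd (sq_nonneg ‖s‖)
  have hcu := mul_le_mul_of_nonneg_right hcc (sq_nonneg ‖u‖)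
  have hggm := mul_le_mul_of_nonneg_right hgg (sq_nonneg ‖g‖)
  have hκm := mul_le_mul_of_nonneg_right hκ (mul_nonneg (mul_pos ht0 hd).le (sq_nonneg ‖h‖))
  have hNm := mul_le_mul_of_nonneg_right hN (sq_nonneg ‖e‖)
  have hY1 := mul_nonneg (mul_pos ht0 hd).le Y1
  have hh1 := mul_le_mul_of_nonneg_left h1 (mul_pos ht0 hd).le
  generalize 1 / t = i at *
  generalize (1 - μ / 2) / (2 * β * (t - 1) * t) = q2 at *
  generalize μ / (4 * β * (t - 1)) = q3 at *
  clear_value A A' c c' W κ j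
  clear hgg hκ hN Y1 h1 hAA hAd hcc exx es exs ez hu hx hz
  simp only [← real_inner_self_eq_norm_sq, inner_add_left, inner_add_right,
    inner_sub_left, inner_sub_right, real_inner_smul_left, real_inner_smul_right,
    real_inner_comm g e, real_inner_comm g h, real_inner_comm g s, real_inner_comm g u,
    real_inner_comm u e, real_inner_comm s e] at h2 Y2 Y3 Y4 hAs hAs2 hcu hggm hκm hNm hY1 hh1 ⊢
  generalize (inner ℝ g g : ℝ) = gg at *
  generalize (inner ℝ g e : ℝ) = ge at *
  generalize (inner ℝ g h : ℝ) = gh at *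
  generalize (inner ℝ g s : ℝ) = gs at *
  generalize (inner ℝ g u : ℝ) = gu at *
  generalize (inner ℝ e e : ℝ) = ee at *
  generalize (inner ℝ h e : ℝ) = he at *
  generalize (inner ℝ s e : ℝ) = se at *
  generalize (inner ℝ u e : ℝ) = ue at *
  generalize (inner ℝ h h : ℝ) = hh at *
  generalize (inner ℝ h s : ℝ) = hs at *
  generalize (inner ℝ s s : ℝ) = ss at *
  generalize (inner ℝ u u : ℝ) = uu at *
  rw [hX] at *
  linear_combination hh1 + h2 + hY1 + Y2 + Y3 + Y4 + hAs + hAs2 + hcu + hggm + hκm + hNm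
    - ((gu + ue) + μ * η / 4 * (gg + 2 * ge + ee)) * hcη - (gs + se) * hAj
    + (gg + 2 * ge + ee) * hAκ + (gs + hs) * htj - (t - 1) * hs * hti
    - t * (gg + ge + gh + he) * hηe

/-- The weight of `‖u‖ ^ 2` is at least `1 / (2 * μ * β)`, so that completing the square in `⟨g, u⟩`
costs only `μ / 2 < 1 / 3` of the weight of `‖g‖ ^ 2`. -/
theorem energy_ge {μ β bbar t : ℝ} (hμ : 0 < μ) (hμ' : μ < 2 / 3) (hβ : 0 < β)
    (hb : β ≤ bbar) (ht : 1 + μ < t) {g s u : E} (h : bbar * ‖g‖ ^ 2 ≤ inner ℝ g (s + u)) :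
    β / 2 * (t - μ) ^ 2 * ‖g‖ ^ 2 ≤ energy μ β t g s u := by
  have hτ : 0 < t - μ := by linarith
  have hd : 0 < t - 1 := by linarith
  have hw : 0 < t - μ / 2 := by linarith
  have hν : 0 < 1 - μ / 2 := by linarith
  have hc : 1 / (2 * μ * β) ≤ (t - μ / 2) / (2 * μ * β * (t - 1)) := by
    rw [div_le_div_iff₀ (by positivity) (by positivity)]
    have : 0 < 2 * μ * β := by positivity
    nlinarith
  have hcu := mul_le_mul_of_nonneg_right hc (sq_nonneg ‖u‖)
  have hA : 0 ≤ μ * t * (t - μ / 2) / (4 * β * (1 - μ / 2) * (t - 1) ^ 2) * ‖s‖ ^ 2 := by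
    have : 0 < t := by linarith
    positivity
  have Y := add_inner_add_nonneg (a := 1 / (2 * μ * β)) (b := -(t - μ))
    (c := (t - μ) ^ 2 * μ * β / 2) (by positivity) (le_of_eq (by field_simp; ring)) u g
  have h1 := mul_le_mul_of_nonneg_left h hτ.le
  rw [inner_add_right, real_inner_comm u g] at h1
  have h2 : β * (t - μ) * ‖g‖ ^ 2 ≤ (t - μ) * (bbar * ‖g‖ ^ 2) := by
    have := mul_le_mul_of_nonneg_right hb (mul_nonneg hτ.le (sq_nonneg ‖g‖))
    linarith
  have h3 : 0 ≤ β * (t - μ) ^ 2 * ‖g‖ ^ 2 * (2 / 3 - μ) := by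
    have : 0 < 2 / 3 - μ := by linarith
    positivity
  have h4 : 0 ≤ β * (t - μ) ^ 2 * ‖g‖ ^ 2 := by positivity
  rw [energy]
  nlinarith

theorem energy_init_le {μ β r : ℝ} (hμ : 0 < μ) (hβ : 0 < β) (hr : 1 < μ * (r - 1)) (g u : E) :
    energy μ β (μ * r) g 0 u ≤ β * (μ ^ 2 * r ^ 2 * ‖g‖ ^ 2
      + (2 * r - 1) / (4 * β ^ 2 * (μ * r - 1)) * ‖u‖ ^ 2) := by
  have h1 : 0 < μ * r - 1 := by linarith
  have e : (μ * r - μ / 2) / (2 * μ * β * (μ * r - 1))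
      = β * ((2 * r - 1) / (4 * β ^ 2 * (μ * r - 1))) := by
    field_simp
    ring
  have h2 : β * (μ * r - μ) * (μ * r - μ - 1) * ‖g‖ ^ 2 ≤ β * (μ ^ 2 * r ^ 2 * ‖g‖ ^ 2) := by
    rw [← mul_assoc]
    refine mul_le_mul_of_nonneg_right ?_ (sq_nonneg _)
    rw [mul_assoc]
    refine mul_le_mul_of_nonneg_left ?_ hβ.le
    nlinarith
  rw [energy, e]
  simp only [inner_zero_right, norm_zero]
  nlinarith

end Energy

/-! ### Random variables with finitely many values -/

section FiniteRange

variable {Ω α γ : Type*}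

/-- `X` takes finitely many values and is measurable for `m`, for the largest σ-algebra on its
codomain, so that every function of `X` is measurable and bounded.
No structure on the codomain is needed. -/
structure IsFinitary (m : MeasurableSpace Ω) (X : Ω → α) : Prop where
  finite_range : (Set.range X).Finite
  measurableSet_preimage : ∀ s : Set α, MeasurableSet[m] (X ⁻¹' s)

theorem IsFinitary.mono {m m' : MeasurableSpace Ω} (h : m ≤ m') {X : Ω → α}
    (hX : IsFinitary m X) : IsFinitary m' X :=
  ⟨hX.1, fun s => h _ (hX.2 s)⟩

theorem IsFinitary.comp {m : MeasurableSpace Ω} {X : Ω → α} (hX : IsFinitary m X) (φ : α → γ) :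
    IsFinitary m (fun w => φ (X w)) :=
  ⟨by rw [show (fun w => φ (X w)) = φ ∘ X from rfl, Set.range_comp]; exact hX.1.image φ,
    fun s => hX.2 (φ ⁻¹' s)⟩

theorem IsFinitary.const (m : MeasurableSpace Ω) (a : α) : IsFinitary m (fun _ : Ω => a) :=
  ⟨Set.finite_range_const, fun s => by by_cases h : a ∈ s <;> simp [h]⟩

theorem IsFinitary.prodMk {m : MeasurableSpace Ω} {X : Ω → α} {Y : Ω → γ}
    (hX : IsFinitary m X) (hY : IsFinitary m Y) : IsFinitary m (fun w => (X w, Y w)) := by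
  refine ⟨(hX.1.prod hY.1).subset ?_, fun s => ?_⟩
  · rintro _ ⟨w, rfl⟩
    exact ⟨⟨w, rfl⟩, ⟨w, rfl⟩⟩
  · have e : (fun w => (X w, Y w)) ⁻¹' s
        = ⋃ a ∈ Set.range X, X ⁻¹' {a} ∩ Y ⁻¹' {y | (a, y) ∈ s} := by
      ext w
      simp only [Set.mem_preimage, Set.mem_iUnion, Set.mem_inter_iff, Set.mem_singleton_iff,
        exists_prop]
      exact ⟨fun h => ⟨X w, ⟨w, rfl⟩, rfl, h⟩, fun ⟨a, _, ha, h⟩ => ha ▸ h⟩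
    rw [e]
    exact MeasurableSet.biUnion hX.1.countable fun a _ => (hX.2 _).inter (hY.2 _)

theorem IsFinitary.pi {ι : Type*} [Finite ι] {m : MeasurableSpace Ω} {X : ι → Ω → α}
    (hX : ∀ i, IsFinitary m (X i)) : IsFinitary m (fun w i => X i w) := by
  have hfin : (Set.range fun w i => X i w).Finite := by
    refine (Set.Finite.pi' fun i => (hX i).1).subset ?_
    rintro _ ⟨w, rfl⟩ i
    exact ⟨w, rfl⟩
  refine ⟨hfin, fun s => ?_⟩
  have e : (fun w i => X i w) ⁻¹' s
      = ⋃ f ∈ (Set.range fun w i => X i w) ∩ s, ⋂ i, X i ⁻¹' {f i} := by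
    ext w
    simp only [Set.mem_preimage, Set.mem_iUnion, Set.mem_iInter, Set.mem_singleton_iff,
      Set.mem_inter_iff, Set.mem_range]
    constructor
    · intro h
      exact ⟨_, ⟨⟨w, rfl⟩, h⟩, fun _ => rfl⟩
    · rintro ⟨f, ⟨-, hf⟩, h⟩
      rwa [show (fun i => X i w) = f from funext h]
  rw [e]
  exact MeasurableSet.biUnion (hfin.inter_of_left s).countable fun f _ =>
    MeasurableSet.iInter fun i => (hX i).2 _

theorem IsFinitary.integrable {mΩ : MeasurableSpace Ω} {P : Measure Ω} [IsFiniteMeasure P]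
    {X : Ω → ℝ} (hX : IsFinitary mΩ X) : Integrable X P := by
  obtain ⟨C, hC⟩ := hX.1.isBounded.exists_norm_le
  have hm : Measurable X := fun s _ => hX.2 s
  exact Integrable.of_bound hm.aestronglyMeasurable C (ae_of_all _ fun w => hC _ ⟨w, rfl⟩)

/-- Fubini's theorem for two independent random variables with finitely many values. -/
theorem integral_comp_of_indep {ι : Type*} [Fintype ι] {m₁ m₂ mΩ : MeasurableSpace Ω}
    {P : Measure Ω} [IsFiniteMeasure P]
    (h₁ : m₁ ≤ mΩ) (h₂ : m₂ ≤ mΩ) (hind : Indep m₁ m₂ P) {X : Ω → α} {Y : Ω → ι}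
    (hX : IsFinitary m₁ X) (hY : IsFinitary m₂ Y) (φ : α → ι → ℝ) :
    ∫ w, φ (X w) (Y w) ∂P = ∑ i, P.real {w | Y w = i} * ∫ w, φ (X w) i ∂P := by
  classical
  have e : ∀ w, φ (X w) (Y w) = ∑ i, φ (X w) i * (if Y w = i then 1 else 0) := by
    intro w; simp
  simp only [e]
  have hXi : ∀ i, IsFinitary m₁ (fun w => φ (X w) i) := fun i => hX.comp fun a => φ a i
  have hYi : ∀ i, IsFinitary m₂ (fun w => if Y w = i then (1 : ℝ) else 0) :=
    fun i => hY.comp fun a => if a = i then (1 : ℝ) else 0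
  rw [integral_finsetSum]
  · refine Finset.sum_congr rfl fun i _ => ?_
    have hi : IndepFun (fun w => φ (X w) i) (fun w => if Y w = i then (1 : ℝ) else 0) P := by
      refine indep_of_indep_of_le_left (indep_of_indep_of_le_right hind ?_) ?_
      · rintro _ ⟨s, -, rfl⟩; exact (hYi i).2 s
      · rintro _ ⟨s, -, rfl⟩; exact (hXi i).2 s
    rw [hi.integral_fun_mul_eq_mul_integral ((hXi i).mono h₁).integrable.aestronglyMeasurable
      ((hYi i).mono h₂).integrable.aestronglyMeasurable, mul_comm]
    congr 1
    have : (fun w => if Y w = i then (1 : ℝ) else 0) = Set.indicator {w | Y w = i} 1 := by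
      ext w; simp [Set.indicator_apply]
    rw [this]
    exact integral_indicator_one (h₂ _ (hY.2 {i}))
  · intro i _
    exact (((hXi i).mono h₁).prodMk ((hYi i).mono h₂)).comp (fun a => a.1 * a.2) |>.integrable

end FiniteRange

/-! ### The variance of the estimator -/

section Sampling

variable {Ω α : Type*} {n b : ℕ} {q : ℕ → ℝ} {S : ℕ → Fin b → Ω → Fin n} {c : ℕ → Ω → Bool}

/-- The σ-algebra generated by the samples and switches with index in `I`. -/
@[reducible] def sampleSigma (S : ℕ → Fin b → Ω → Fin n) (c : ℕ → Ω → Bool)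
    (I : Set ((ℕ × Fin b) ⊕ ℕ)) : MeasurableSpace Ω :=
  ⨆ i ∈ I, Sum.elim (fun a : ℕ × Fin b => MeasurableSpace.comap (S a.1 a.2) ⊤)
    (fun k => MeasurableSpace.comap (c k) ⊤) i

theorem sampleSigma_mono {I J : Set ((ℕ × Fin b) ⊕ ℕ)} (h : I ⊆ J) :
    sampleSigma S c I ≤ sampleSigma S c J :=
  biSup_mono h

theorem isFinitary_sample {I : Set ((ℕ × Fin b) ⊕ ℕ)} {k : ℕ} {j : Fin b}
    (h : Sum.inl (k, j) ∈ I) : IsFinitary (sampleSigma S c I) (S k j) := by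
  refine ⟨Set.toFinite _, fun s => ?_⟩
  have : MeasurableSpace.comap (S k j) ⊤ ≤ sampleSigma S c I :=
    le_biSup (fun i => Sum.elim (fun a : ℕ × Fin b => MeasurableSpace.comap (S a.1 a.2) ⊤)
      (fun k => MeasurableSpace.comap (c k) ⊤) i) h
  exact this _ ⟨s, trivial, rfl⟩

theorem isFinitary_switch {I : Set ((ℕ × Fin b) ⊕ ℕ)} {k : ℕ}
    (h : Sum.inr k ∈ I) : IsFinitary (sampleSigma S c I) (c k) := by
  refine ⟨Set.toFinite _, fun s => ?_⟩
  have : MeasurableSpace.comap (c k) ⊤ ≤ sampleSigma S c I :=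
    le_biSup (fun i => Sum.elim (fun a : ℕ × Fin b => MeasurableSpace.comap (S a.1 a.2) ⊤)
      (fun k => MeasurableSpace.comap (c k) ⊤) i) h
  exact this _ ⟨s, trivial, rfl⟩

variable [MeasurableSpace Ω] {P : Measure Ω}

theorem IsSampling.le (hS : IsSampling P q S c) (i : (ℕ × Fin b) ⊕ ℕ) :
    Sum.elim (fun a : ℕ × Fin b => MeasurableSpace.comap (S a.1 a.2) ⊤)
      (fun k => MeasurableSpace.comap (c k) ⊤) i ≤ (inferInstance : MeasurableSpace Ω) := by
  rcases i with ⟨k, j⟩ | k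
  · exact (hS.measurable_S k j).comap_le
  · exact (hS.measurable_c k).comap_le

theorem IsSampling.sampleSigma_le (hS : IsSampling P q S c) (I : Set ((ℕ × Fin b) ⊕ ℕ)) :
    sampleSigma S c I ≤ (inferInstance : MeasurableSpace Ω) :=
  iSup₂_le fun i _ => hS.le i

theorem IsSampling.indep_sampleSigma (hS : IsSampling P q S c) {I J : Set ((ℕ × Fin b) ⊕ ℕ)}
    (h : Disjoint I J) : Indep (sampleSigma S c I) (sampleSigma S c J) P :=
  indep_iSup_of_disjoint hS.le hS.indep h

variable [IsProbabilityMeasure P]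

theorem IsSampling.integral_sample (hS : IsSampling P q S c) {I : Set ((ℕ × Fin b) ⊕ ℕ)}
    {X : Ω → α} (hX : IsFinitary (sampleSigma S c I) X) {k : ℕ} {j : Fin b}
    (h : Sum.inl (k, j) ∉ I) (φ : α → Fin n → ℝ) :
    ∫ w, φ (X w) (S k j w) ∂P = ∫ w, 1 / (n : ℝ) * ∑ i, φ (X w) i ∂P := by
  rw [integral_comp_of_indep (hS.sampleSigma_le _) (hS.sampleSigma_le _)
    (hS.indep_sampleSigma (Set.disjoint_singleton_right.2 h)) hX
    (isFinitary_sample (Set.mem_singleton _)) φ, integral_const_mul, integral_finsetSum,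
    Finset.mul_sum]
  · simp only [hS.uniform]
  · exact fun i _ => ((hX.comp fun a => φ a i).mono (hS.sampleSigma_le _)).integrable

theorem IsSampling.integral_switch (hS : IsSampling P q S c) {I : Set ((ℕ × Fin b) ⊕ ℕ)}
    {X : Ω → α} (hX : IsFinitary (sampleSigma S c I) X) {k : ℕ} (hk : 1 ≤ k)
    (h : Sum.inr k ∉ I) (φ : α → Bool → ℝ) :
    ∫ w, φ (X w) (c k w) ∂P
      = ∫ w, (q k * φ (X w) true + (1 - q k) * φ (X w) false) ∂P := by
  have key := fun ψ : α → Bool → ℝ =>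
    integral_comp_of_indep (hS.sampleSigma_le _) (hS.sampleSigma_le _)
      (hS.indep_sampleSigma (Set.disjoint_singleton_right.2 h)) hX
      (isFinitary_switch (Set.mem_singleton _)) ψ
  have h1 := key fun _ _ => 1
  simp only [Fintype.sum_bool, hS.bernoulli k hk, integral_const, probReal_univ, smul_eq_mul,
    mul_one] at h1
  have hint : ∀ i : Bool, ∀ a : ℝ, Integrable (fun w => a * φ (X w) i) P := fun i a =>
    ((hX.comp fun x => a * φ x i).mono (hS.sampleSigma_le _)).integrable
  rw [key φ, Fintype.sum_bool, hS.bernoulli k hk, integral_add (hint _ _) (hint _ _),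
    integral_const_mul, integral_const_mul]
  congr 2
  linarith

theorem IsSampling.switch_mem_Icc (hS : IsSampling P q S c) {k : ℕ} (hk : 1 ≤ k) :
    0 ≤ q k ∧ q k ≤ 1 := by
  rw [← hS.bernoulli k hk]
  exact ⟨measureReal_nonneg, measureReal_le_one⟩

/-- The mean of `b` independent uniform samples has variance `1 / b` times the variance of one
sample; the sampled family may depend on an independent `X`. -/
theorem IsSampling.integral_norm_mean_sq {E : Type*} [NormedAddCommGroup E]
    [InnerProductSpace ℝ E] (hS : IsSampling P q S c) (hb : 1 ≤ b) {I : Set ((ℕ × Fin b) ⊕ ℕ)}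
    {X : Ω → α} (hX : IsFinitary (sampleSigma S c I) X) {k : ℕ}
    (h : ∀ j, Sum.inl (k, j) ∉ I) (ζ : α → Fin n → E) (hζ : ∀ a, ∑ i, ζ a i = 0) :
    ∫ w, ‖(1 / (b : ℝ)) • ∑ j, ζ (X w) (S k j w)‖ ^ 2 ∂P
      = 1 / (b : ℝ) * ∫ w, 1 / (n : ℝ) * ∑ i, ‖ζ (X w) i‖ ^ 2 ∂P := by
  have hb0 : (b : ℝ) ≠ 0 := by positivity
  have e : ∀ w, ‖(1 / (b : ℝ)) • ∑ j, ζ (X w) (S k j w)‖ ^ 2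
      = (1 / (b : ℝ)) ^ 2 * ∑ j, ∑ l, inner ℝ (ζ (X w) (S k j w)) (ζ (X w) (S k l w)) := by
    intro w
    rw [norm_smul, mul_pow, Real.norm_eq_abs, sq_abs, ← real_inner_self_eq_norm_sq, sum_inner]
    simp only [inner_sum]
  have hXS : ∀ l, IsFinitary (sampleSigma S c (insert (Sum.inl (k, l)) I))
      (fun w => (X w, S k l w)) := fun l =>
    (hX.mono (sampleSigma_mono (Set.subset_insert _ _))).prodMk
      (isFinitary_sample (Set.mem_insert _ _))
  have hint : ∀ j l, Integrable
      (fun w => (inner ℝ (ζ (X w) (S k j w)) (ζ (X w) (S k l w)) : ℝ)) P := fun j l =>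
    ((((hXS j).mono (hS.sampleSigma_le _)).prodMk ((hXS l).mono (hS.sampleSigma_le _))).comp
      fun a => (inner ℝ (ζ a.1.1 a.1.2) (ζ a.2.1 a.2.2) : ℝ)).integrable
  have hoff : ∀ j l, j ≠ l →
      ∫ w, inner ℝ (ζ (X w) (S k j w)) (ζ (X w) (S k l w)) ∂P = 0 := by
    intro j l hjl
    have := hS.integral_sample (hXS l) (k := k) (j := j) (by simp [hjl, h])
      (fun a i => inner ℝ (ζ a.1 i) (ζ a.1 a.2))
    simp only [← sum_inner, hζ, inner_zero_left, mul_zero, integral_zero] at this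
    exact this
  have hdiag : ∀ j, ∫ w, inner ℝ (ζ (X w) (S k j w)) (ζ (X w) (S k j w)) ∂P
      = ∫ w, 1 / (n : ℝ) * ∑ i, ‖ζ (X w) i‖ ^ 2 ∂P := by
    intro j
    have := hS.integral_sample hX (h j) (fun a i => inner ℝ (ζ a i) (ζ a i))
    rw [this]
    simp only [real_inner_self_eq_norm_sq]
  simp only [e]
  rw [integral_const_mul,
    integral_finsetSum _ fun j _ => integrable_finsetSum _ fun l _ => hint j l]
  have : ∀ j, ∫ w, ∑ l, inner ℝ (ζ (X w) (S k j w)) (ζ (X w) (S k l w)) ∂P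
      = ∫ w, 1 / (n : ℝ) * ∑ i, ‖ζ (X w) i‖ ^ 2 ∂P := by
    intro j
    rw [integral_finsetSum _ fun l _ => hint j l, Finset.sum_eq_single j
      (fun l _ hl => hoff j l hl.symm) (by simp), hdiag]
  simp only [this, Finset.sum_const, Finset.card_univ, Fintype.card_fin, nsmul_eq_mul]
  field_simp

end Sampling

section Estimator

variable {p n b : ℕ} {F : Fin n → EuclideanSpace ℝ (Fin p) → EuclideanSpace ℝ (Fin p)}

/-- The variance-reduced estimator of `F x` with snapshot point `y` and mini-batch `s`. -/
noncomputable def estimator (F : Fin n → EuclideanSpace ℝ (Fin p) → EuclideanSpace ℝ (Fin p))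
    (s : Fin b → Fin n) (x y : EuclideanSpace ℝ (Fin p)) : EuclideanSpace ℝ (Fin p) :=
  avg F y + ((1 / (b : ℝ)) • ∑ j, F (s j) x - (1 / (b : ℝ)) • ∑ j, F (s j) y)

theorem estimator_sub_avg (hb : 1 ≤ b) (s : Fin b → Fin n) (x y : EuclideanSpace ℝ (Fin p)) :
    estimator F s x y - avg F x
      = (1 / (b : ℝ)) • ∑ j, ((F (s j) x - F (s j) y) - (avg F x - avg F y)) := by
  have hb0 : (b : ℝ) ≠ 0 := by positivity
  rw [estimator, Finset.sum_sub_distrib, Finset.sum_sub_distrib, Finset.sum_const,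
    Finset.card_univ, Fintype.card_fin, smul_sub, smul_sub, ← Nat.cast_smul_eq_nsmul ℝ, smul_smul,
    one_div_mul_cancel hb0]
  module

/-- The variance is at most the second moment. -/
theorem mean_norm_sub_avg_sq_le (hn : 1 ≤ n) (x y : EuclideanSpace ℝ (Fin p)) :
    1 / (n : ℝ) * ∑ i, ‖(F i x - F i y) - (avg F x - avg F y)‖ ^ 2 ≤ meanSqDist F x y := by
  have hn0 : (n : ℝ) ≠ 0 := by positivity
  have e : avg F x - avg F y = (1 / (n : ℝ)) • ∑ i, (F i x - F i y) := by
    simp only [avg, Finset.sum_sub_distrib, smul_sub]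
  set v := avg F x - avg F y
  have e2 : ∑ i, (F i x - F i y) = (n : ℝ) • v := by
    rw [e, smul_smul, mul_one_div_cancel hn0, one_smul]
  simp only [norm_sub_sq_real _ v, Finset.sum_add_distrib, Finset.sum_sub_distrib,
    ← Finset.mul_sum, ← sum_inner, e2, real_inner_smul_left, real_inner_self_eq_norm_sq,
    Finset.sum_const, Finset.card_univ, Fintype.card_fin, nsmul_eq_mul, meanSqDist]
  have : 0 ≤ ‖v‖ ^ 2 := by positivity
  have e3 : 1 / (n : ℝ) * (∑ i, ‖F i x - F i y‖ ^ 2 - 2 * (n * ‖v‖ ^ 2) + n * ‖v‖ ^ 2)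
      = 1 / (n : ℝ) * ∑ i, ‖F i x - F i y‖ ^ 2 - ‖v‖ ^ 2 := by
    field_simp
    ring
  rw [e3]
  linarith

theorem sum_sub_avg_eq_zero (hn : 1 ≤ n) (x y : EuclideanSpace ℝ (Fin p)) :
    ∑ i, ((F i x - F i y) - (avg F x - avg F y)) = 0 := by
  have hn0 : (n : ℝ) ≠ 0 := by positivity
  simp only [Finset.sum_sub_distrib, Finset.sum_const, Finset.card_univ, Fintype.card_fin, avg,
    ← Nat.cast_smul_eq_nsmul ℝ, smul_smul, mul_one_div_cancel hn0, one_smul]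
  abel

/-- Moving the snapshot point from `y` to `x'` with probability `a` contracts the mean square
distance of the snapshot point to the iterate, up to the length of the last step. -/
theorem meanSqDist_mix_le {a : ℝ} (ha : 0 < a) (ha1 : a ≤ 1)
    (x x' y : EuclideanSpace ℝ (Fin p)) :
    a * meanSqDist F x x' + (1 - a) * meanSqDist F x y
      ≤ (1 - a / 2) * meanSqDist F x' y + 2 / a * meanSqDist F x x' := by
  have key : ∀ i, a * ‖F i x - F i x'‖ ^ 2 + (1 - a) * ‖F i x - F i y‖ ^ 2
      ≤ (1 - a / 2) * ‖F i x' - F i y‖ ^ 2 + 2 / a * ‖F i x - F i x'‖ ^ 2 := by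
    intro i
    rw [show F i x - F i y = (F i x - F i x') + (F i x' - F i y) by abel]
    generalize F i x - F i x' = v
    generalize F i x' - F i y = w
    have h := sq_nonneg ‖w - (2 * (1 - a) / a) • v‖
    rw [norm_sub_sq_real, norm_smul, real_inner_smul_right, mul_pow, Real.norm_eq_abs, sq_abs,
      real_inner_comm] at h
    rw [norm_add_sq_real]
    have h2 := mul_nonneg (half_pos ha).le h
    have e : a / 2 * (‖w‖ ^ 2 - 2 * (2 * (1 - a) / a * inner ℝ v w)
        + (2 * (1 - a) / a) ^ 2 * ‖v‖ ^ 2)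
        = a / 2 * ‖w‖ ^ 2 - 2 * (1 - a) * inner ℝ v w + (2 / a - 4 + 2 * a) * ‖v‖ ^ 2 := by
      field_simp
      ring
    rw [e] at h2
    have h3 : 0 ≤ (3 - 2 * a) * ‖v‖ ^ 2 := mul_nonneg (by linarith) (by positivity)
    linarith
  have hs : ∀ u v w z t : ℝ, ∀ f g h : Fin n → ℝ,
      (∀ i, u * f i + v * g i ≤ w * h i + z * f i) → 0 ≤ t →
      u * (t * ∑ i, f i) + v * (t * ∑ i, g i) ≤ w * (t * ∑ i, h i) + z * (t * ∑ i, f i) := by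
    intro u v w z t f g h hle ht
    have := mul_le_mul_of_nonneg_left (Finset.sum_le_sum fun i (_ : i ∈ Finset.univ) => hle i) ht
    simp only [Finset.sum_add_distrib, ← Finset.mul_sum] at this
    linarith
  exact hs _ _ _ _ _ _ _ _ key (by positivity)

end Estimator

/-! ### The iterates of the algorithm -/

section Run

variable {p n b : ℕ} {lam μ r β : ℝ}
  {F : Fin n → EuclideanSpace ℝ (Fin p) → EuclideanSpace ℝ (Fin p)}
  {T : EuclideanSpace ℝ (Fin p) → Set (EuclideanSpace ℝ (Fin p))}
  {x0 : EuclideanSpace ℝ (Fin p)}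

theorem run_Fsnap (S : ℕ → Fin b → Fin n) (c : ℕ → Bool) (k : ℕ) :
    (run lam μ r β F T x0 S c k).Fsnap = avg F (run lam μ r β F T x0 S c k).snap := by
  induction k with
  | zero => rfl
  | succ k ih =>
    simp only [run, step]
    split_ifs
    · rfl
    · exact ih

theorem run_succ_snap (S : ℕ → Fin b → Fin n) (c : ℕ → Bool) (k : ℕ) :
    (run lam μ r β F T x0 S c (k + 1)).snap
      = if 1 ≤ k ∧ c k = true then (run lam μ r β F T x0 S c k).xprev
        else (run lam μ r β F T x0 S c k).snap := rfl

theorem run_jCalls (S : ℕ → Fin b → Fin n) (c : ℕ → Bool) (k : ℕ) :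
    (run lam μ r β F T x0 S c k).jCalls = k := by
  induction k with
  | zero => rfl
  | succ k ih =>
    change (run lam μ r β F T x0 S c k).jCalls + 1 = k + 1
    rw [ih]

theorem run_succ_fCalls (S : ℕ → Fin b → Fin n) (c : ℕ → Bool) (k : ℕ) :
    (run lam μ r β F T x0 S c (k + 1)).fCalls
      = (run lam μ r β F T x0 S c k).fCalls + (if 1 ≤ k ∧ c k = true then n else 0) + 2 * b := rfl

/-- One iteration in terms of the error `e` of the computed residual. -/
theorem exists_run_succ (hT : MaxCoHypomonotone ρ T) (h0 : 0 < lam) (hρ : 0 ≤ ρ)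
    (hlam : 2 * ρ ≤ lam) (S : ℕ → Fin b → Fin n) (c : ℕ → Bool) {k : ℕ} (ht : tSeq μ r k ≠ 0) :
    ∃ e : EuclideanSpace ℝ (Fin p),
      ‖e‖ ≤ ‖estimator F (S k) (run lam μ r β F T x0 S c k).x
          (run lam μ r β F T x0 S c (k + 1)).snap - avg F (run lam μ r β F T x0 S c k).x‖ ∧
      (run lam μ r β F T x0 S c (k + 1)).x = (run lam μ r β F T x0 S c k).x
        - (1 / tSeq μ r k) • ((run lam μ r β F T x0 S c k).x - (run lam μ r β F T x0 S c k).z)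
        - etaSeq μ r β k • (residual lam (avg F) T (run lam μ r β F T x0 S c k).x + e) ∧
      (run lam μ r β F T x0 S c (k + 1)).z = (run lam μ r β F T x0 S c k).z
        - (μ / 2 * etaSeq μ r β k)
          • (residual lam (avg F) T (run lam μ r β F T x0 S c k).x + e) := by
  have hest : (if 1 ≤ k ∧ c k = true then avg F (run lam μ r β F T x0 S c k).xprev
      else (run lam μ r β F T x0 S c k).Fsnap)
      = avg F (run lam μ r β F T x0 S c (k + 1)).snap := by
    rw [run_succ_snap]
    split_ifs
    · rfl
    · exact run_Fsnap S c k
  set st := run lam μ r β F T x0 S c k with hst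
  set st' := run lam μ r β F T x0 S c (k + 1) with hst'
  set f := estimator F (S k) st.x st'.snap with hf
  set g' := (1 / lam) • (st.x - resolvent lam T (st.x - lam • f)) with hg'
  have hx : st'.x = ((tSeq μ r k - 1) / tSeq μ r k) • st.x + (1 / tSeq μ r k) • st.z
      - etaSeq μ r β k • g' := by
    rw [hg', hf, estimator, ← hest]
    rfl
  have hz : st'.z = st.z + (μ / 2) • (st'.x
      - (((tSeq μ r k - 1) / tSeq μ r k) • st.x + (1 / tSeq μ r k) • st.z)) := rfl
  refine ⟨g' - residual lam (avg F) T st.x,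
    norm_forwardBackward_sub_le hT h0 hρ hlam st.x f (avg F st.x), ?_, ?_⟩
  · rw [hx, sub_div, div_self ht]
    module
  · rw [hz, hx]
    module

end Run

section Expectation

variable {p n b : ℕ} {lam μ r β : ℝ}
  {F : Fin n → EuclideanSpace ℝ (Fin p) → EuclideanSpace ℝ (Fin p)}
  {T : EuclideanSpace ℝ (Fin p) → Set (EuclideanSpace ℝ (Fin p))}
  {x0 : EuclideanSpace ℝ (Fin p)}
  {Ω : Type*} {q : ℕ → ℝ} {S : ℕ → Fin b → Ω → Fin n} {c : ℕ → Ω → Bool}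

/-- The indices of the samples and switches that are used before iteration `k`. -/
def pastIndices (b k : ℕ) : Set ((ℕ × Fin b) ⊕ ℕ) :=
  {i | Sum.elim (fun a : ℕ × Fin b => a.1 < k) (fun l => l < k) i}

/-- The state of the algorithm before iteration `k`, as a random variable. -/
noncomputable def randomState (lam μ r β : ℝ)
    (F : Fin n → EuclideanSpace ℝ (Fin p) → EuclideanSpace ℝ (Fin p))
    (T : EuclideanSpace ℝ (Fin p) → Set (EuclideanSpace ℝ (Fin p)))
    (x0 : EuclideanSpace ℝ (Fin p)) (S : ℕ → Fin b → Ω → Fin n) (c : ℕ → Ω → Bool)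
    (k : ℕ) (w : Ω) : State p :=
  run lam μ r β F T x0 (fun k j => S k j w) (fun k => c k w) k

local notation "X" => randomState lam μ r β F T x0 S c

theorem isFinitary_randomState (k : ℕ) :
    IsFinitary (sampleSigma S c (pastIndices b k)) (X k) := by
  induction k with
  | zero => exact IsFinitary.const _ (initState F x0)
  | succ k ih =>
    have h1 : pastIndices b k ⊆ pastIndices b (k + 1) := by
      rintro (⟨l, j⟩ | l) h
      · exact Nat.lt_succ_of_lt h
      · exact Nat.lt_succ_of_lt h
    have h2 : IsFinitary (sampleSigma S c (pastIndices b (k + 1))) (fun w j => S k j w) :=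
      IsFinitary.pi fun j => isFinitary_sample (Nat.lt_succ_self k)
    have h3 : IsFinitary (sampleSigma S c (pastIndices b (k + 1))) (c k) :=
      isFinitary_switch (Nat.lt_succ_self k)
    exact ((h2.prodMk h3).prodMk (ih.mono (sampleSigma_mono h1))).comp
      fun a => step lam μ r β F T k a.1.1 a.1.2 a.2

variable [MeasurableSpace Ω] {P : Measure Ω}

theorem IsSampling.isFinitary_randomState (hS : IsSampling P q S c) (k : ℕ) :
    IsFinitary (inferInstance : MeasurableSpace Ω) (X k) :=
  (VFOSA.isFinitary_randomState k).mono (hS.sampleSigma_le _)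

theorem IsSampling.integral_estimator_le [IsProbabilityMeasure P] (hS : IsSampling P q S c)
    (hn : 1 ≤ n) (hb : 1 ≤ b) (k : ℕ) :
    ∫ w, ‖estimator F (fun j => S k j w) (X k w).x (X (k + 1) w).snap - avg F (X k w).x‖ ^ 2 ∂P
      ≤ 1 / (b : ℝ) * ∫ w, meanSqDist F (X k w).x (X (k + 1) w).snap ∂P := by
  have hX : IsFinitary (sampleSigma S c (insert (Sum.inr k) (pastIndices b k)))
      (fun w => ((X k w).x, (X (k + 1) w).snap)) :=
    ((isFinitary_switch (Set.mem_insert _ _)).prodMk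
      ((VFOSA.isFinitary_randomState k).mono (sampleSigma_mono (Set.subset_insert _ _)))).comp
      fun a : Bool × State p => (a.2.x, if 1 ≤ k ∧ a.1 = true then a.2.xprev else a.2.snap)
  have h := hS.integral_norm_mean_sq hb hX (k := k) (fun j => by simp [pastIndices])
    (fun a i => (F i a.1 - F i a.2) - (avg F a.1 - avg F a.2))
    (fun a => sum_sub_avg_eq_zero hn a.1 a.2)
  simp only [estimator_sub_avg hb]
  rw [h]
  refine mul_le_mul_of_nonneg_left ?_ (by positivity)
  refine integral_mono ?_ ?_ fun w => mean_norm_sub_avg_sq_le hn _ _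
  · exact ((hX.mono (hS.sampleSigma_le _)).comp fun a =>
      1 / (n : ℝ) * ∑ i, ‖(F i a.1 - F i a.2) - (avg F a.1 - avg F a.2)‖ ^ 2).integrable
  · exact ((hX.mono (hS.sampleSigma_le _)).comp fun a => meanSqDist F a.1 a.2).integrable

/-- The expected mean square distance of `x^k` to the snapshot point used in iteration `k`. -/
noncomputable def snapGap (P : Measure Ω) (lam μ r β : ℝ)
    (F : Fin n → EuclideanSpace ℝ (Fin p) → EuclideanSpace ℝ (Fin p))
    (T : EuclideanSpace ℝ (Fin p) → Set (EuclideanSpace ℝ (Fin p)))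
    (x0 : EuclideanSpace ℝ (Fin p)) (S : ℕ → Fin b → Ω → Fin n) (c : ℕ → Ω → Bool)
    (k : ℕ) : ℝ :=
  ∫ w, meanSqDist F (randomState lam μ r β F T x0 S c k w).x
    (randomState lam μ r β F T x0 S c (k + 1) w).snap ∂P

/-- The expected mean square distance of `x^{k+1}` to `x^k`. -/
noncomputable def stepGap (P : Measure Ω) (lam μ r β : ℝ)
    (F : Fin n → EuclideanSpace ℝ (Fin p) → EuclideanSpace ℝ (Fin p))
    (T : EuclideanSpace ℝ (Fin p) → Set (EuclideanSpace ℝ (Fin p)))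
    (x0 : EuclideanSpace ℝ (Fin p)) (S : ℕ → Fin b → Ω → Fin n) (c : ℕ → Ω → Bool)
    (k : ℕ) : ℝ :=
  ∫ w, meanSqDist F (randomState lam μ r β F T x0 S c (k + 1) w).x
    (randomState lam μ r β F T x0 S c k w).x ∂P

/-- The expected energy before iteration `k`. -/
noncomputable def meanEnergy (P : Measure Ω) (lam μ r β : ℝ)
    (F : Fin n → EuclideanSpace ℝ (Fin p) → EuclideanSpace ℝ (Fin p))
    (T : EuclideanSpace ℝ (Fin p) → Set (EuclideanSpace ℝ (Fin p)))
    (x0 xstar : EuclideanSpace ℝ (Fin p)) (S : ℕ → Fin b → Ω → Fin n) (c : ℕ → Ω → Bool)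
    (k : ℕ) : ℝ :=
  ∫ w, energy μ β (tSeq μ r k)
    (residual lam (avg F) T (randomState lam μ r β F T x0 S c k w).x)
    ((randomState lam μ r β F T x0 S c k w).x - (randomState lam μ r β F T x0 S c k w).z)
    ((randomState lam μ r β F T x0 S c k w).z - xstar) ∂P

theorem snapGap_nonneg (k : ℕ) : 0 ≤ snapGap P lam μ r β F T x0 S c k :=
  integral_nonneg fun _ => meanSqDist_nonneg _ _

theorem stepGap_nonneg (k : ℕ) : 0 ≤ stepGap P lam μ r β F T x0 S c k :=
  integral_nonneg fun _ => meanSqDist_nonneg _ _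

theorem snapGap_zero : snapGap P lam μ r β F T x0 S c 0 = 0 := by
  have : ∀ w, meanSqDist F (X 0 w).x (X (0 + 1) w).snap = 0 := by
    intro w
    have h : (X (0 + 1) w).snap = (X 0 w).x := by
      simp only [randomState, run_succ_snap]
      rfl
    rw [h, meanSqDist_self]
  simp only [snapGap, this, integral_zero]

theorem IsSampling.snapGap_succ_le [IsProbabilityMeasure P] (hS : IsSampling P q S c) (k : ℕ)
    (hq : 0 < q (k + 1)) :
    snapGap P lam μ r β F T x0 S c (k + 1)
      ≤ (1 - q (k + 1) / 2) * snapGap P lam μ r β F T x0 S c k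
        + 2 / q (k + 1) * stepGap P lam μ r β F T x0 S c k := by
  have h := hS.integral_switch (VFOSA.isFinitary_randomState (lam := lam) (μ := μ) (r := r)
      (β := β) (F := F) (T := T) (x0 := x0) (S := S) (c := c) (k + 1))
    (k := k + 1) (by omega) (by simp [pastIndices])
    (fun st cb => meanSqDist F st.x (if 1 ≤ k + 1 ∧ cb = true then st.xprev else st.snap))
  have e : snapGap P lam μ r β F T x0 S c (k + 1) = ∫ w, meanSqDist F (X (k + 1) w).x
    (if 1 ≤ k + 1 ∧ c (k + 1) w = true then (X (k + 1) w).xprev else (X (k + 1) w).snap) ∂P := rfl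
  have hfin := (hS.isFinitary_randomState (lam := lam) (μ := μ) (r := r)
      (β := β) (F := F) (T := T) (x0 := x0) (k + 1))
  have hfin2 := hfin.prodMk (hS.isFinitary_randomState (lam := lam) (μ := μ) (r := r)
      (β := β) (F := F) (T := T) (x0 := x0) k)
  rw [e, h, snapGap, stepGap, ← integral_const_mul, ← integral_const_mul, ← integral_add]
  · refine integral_mono ?_ ?_ fun w => ?_
    · exact (hfin.comp fun st => q (k + 1) * meanSqDist F st.x
        (if 1 ≤ k + 1 ∧ true = true then st.xprev else st.snap) + (1 - q (k + 1)) *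
        meanSqDist F st.x (if 1 ≤ k + 1 ∧ false = true then st.xprev else st.snap)).integrable
    · exact (hfin2.comp fun a => (1 - q (k + 1) / 2) * meanSqDist F a.2.x a.1.snap
        + 2 / q (k + 1) * meanSqDist F a.1.x a.2.x).integrable
    · have := meanSqDist_mix_le (F := F) hq (hS.switch_mem_Icc (by omega)).2 (X (k + 1) w).x
        (X k w).x (X (k + 1) w).snap
      have e' : (X (k + 1) w).xprev = (X k w).x := rfl
      simpa [e'] using this
  · exact (hfin2.comp fun a => (1 - q (k + 1) / 2) * meanSqDist F a.2.x a.1.snap).integrable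
  · exact (hfin2.comp fun a => 2 / q (k + 1) * meanSqDist F a.1.x a.2.x).integrable

/-! ### The expected energy -/

theorem Constants.tSeq_gt {L Lhat ρ cp : ℝ} (h : Constants L Lhat ρ lam μ r β cp) (k : ℕ) :
    1 + 5 * μ < tSeq μ r k := by
  have h1 := mul_lt_mul_of_pos_left h.r_gt h.μ_pos
  rw [mul_add, mul_one_div_cancel h.μ_pos.ne'] at h1
  have h2 : 0 ≤ μ * k := mul_nonneg h.μ_pos.le (Nat.cast_nonneg k)
  rw [tSeq]
  linarith

theorem Constants.le_betaBar {L Lhat ρ cp : ℝ} (h : Constants L Lhat ρ lam μ r β cp) :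
    (2 + μ) * β ≤ (2 - μ) * betaBar Lhat ρ lam := by
  have h1 := h.β_le
  rw [le_div_iff₀ (by linarith [h.μ_pos])] at h1
  linarith

theorem Constants.β_le_betaBar {L Lhat ρ cp : ℝ} (h : Constants L Lhat ρ lam μ r β cp) :
    β ≤ betaBar Lhat ρ lam := by
  have h1 := h.le_betaBar
  have h2 := h.μ_pos
  have h3 := h.μ_lt
  have h4 := h.β_pos
  have h5 : 0 < betaBar Lhat ρ lam := by
    by_contra hc
    push Not at hc
    nlinarith [mul_pos h2 h4]
  nlinarith [mul_pos h2 h4, mul_pos h2 h5]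

theorem Constants.bigLambda_pos {L Lhat ρ cp : ℝ} (h : Constants L Lhat ρ lam μ r β cp) :
    0 < bigLambda L Lhat :=
  div_pos (sub_pos.2 h.L_lt) (mul_pos h.L_pos (h.L_pos.trans h.L_lt))

theorem Constants.ρ_lt_lam {L Lhat ρ cp : ℝ} (h : Constants L Lhat ρ lam μ r β cp) :
    ρ < lam := by
  linarith [h.lam_pos, h.lam_ge]

theorem tSeq_succ (k : ℕ) : tSeq μ r (k + 1) = tSeq μ r k + μ := by
  simp only [tSeq]
  push_cast
  ring

section MeanEnergy

variable {L Lhat ρ cp : ℝ} {xstar : EuclideanSpace ℝ (Fin p)}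

theorem betaBar_mul_le_inner (h : Constants L Lhat ρ lam μ r β cp) (hF : AverageCocoercive L F)
    (hT : MaxCoHypomonotone ρ T) (hx : xstar ∈ zer (avg F) T) (x : EuclideanSpace ℝ (Fin p)) :
    betaBar Lhat ρ lam * ‖residual lam (avg F) T x‖ ^ 2
      ≤ inner ℝ (residual lam (avg F) T x) (x - xstar) := by
  have h1 := residual_cocoercive hF hT h.L_pos h.L_lt h.Lhat_mul_lt h.lam_pos h.ρ_lt_lam x xstar
  rw [residual_eq_zero hT h.lam_pos h.ρ_lt_lam hx, sub_zero] at h1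
  have h2 := mul_nonneg h.bigLambda_pos.le (meanSqDist_nonneg (F := F) x xstar)
  linarith

theorem IsSampling.meanEnergy_succ_le [IsProbabilityMeasure P] (hS : IsSampling P q S c)
    (h : Constants L Lhat ρ lam μ r β cp) (hF : AverageCocoercive L F)
    (hT : MaxCoHypomonotone ρ T) (hx : xstar ∈ zer (avg F) T) (hn : 1 ≤ n) (hb : 1 ≤ b) (k : ℕ) :
    meanEnergy P lam μ r β F T x0 xstar S c (k + 1) + tSeq μ r k * (tSeq μ r k - 1)
        * (bigLambda L Lhat * stepGap P lam μ r β F T x0 S c k)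
      ≤ meanEnergy P lam μ r β F T x0 xstar S c k + 5 * β / (2 * μ)
        * (tSeq μ r k * (tSeq μ r k - 1))
        * (1 / (b : ℝ) * snapGap P lam μ r β F T x0 S c k) := by
  have ht := h.tSeq_gt k
  have hμ := h.μ_pos
  have hβ := h.β_pos
  have ht0 : 0 < tSeq μ r k := by linarith
  have htt : 0 < tSeq μ r k * (tSeq μ r k - 1) := mul_pos ht0 (by linarith)
  set t := tSeq μ r k with htd
  have hf0 := hS.isFinitary_randomState (lam := lam) (μ := μ) (r := r) (β := β) (F := F) (T := T)
    (x0 := x0) k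
  have hf1 := hS.isFinitary_randomState (lam := lam) (μ := μ) (r := r) (β := β) (F := F) (T := T)
    (x0 := x0) (k + 1)
  have hfS : IsFinitary (inferInstance : MeasurableSpace Ω) (fun w j => S k j w) :=
    (IsFinitary.pi fun j => isFinitary_sample (I := {i | i.isLeft}) (c := c) rfl).mono
      (hS.sampleSigma_le _)
  have hi0 : Integrable (fun w => energy μ β t (residual lam (avg F) T (X k w).x)
      ((X k w).x - (X k w).z) ((X k w).z - xstar)) P :=
    (hf0.comp fun st => energy μ β t (residual lam (avg F) T st.x)
      (st.x - st.z) (st.z - xstar)).integrable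
  have hi1 : Integrable (fun w => energy μ β (tSeq μ r (k + 1))
      (residual lam (avg F) T (X (k + 1) w).x)
      ((X (k + 1) w).x - (X (k + 1) w).z) ((X (k + 1) w).z - xstar)) P :=
    (hf1.comp fun st => energy μ β (tSeq μ r (k + 1)) (residual lam (avg F) T st.x)
      (st.x - st.z) (st.z - xstar)).integrable
  have hi2 : Integrable (fun w => t * (t - 1)
      * (bigLambda L Lhat * meanSqDist F (X (k + 1) w).x (X k w).x)) P :=
    ((hf1.prodMk hf0).comp fun a => t * (t - 1)
      * (bigLambda L Lhat * meanSqDist F a.1.x a.2.x)).integrable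
  have hi3 : Integrable (fun w => 5 * β / (2 * μ) * (t * (t - 1))
      * ‖estimator F (fun j => S k j w) (X k w).x (X (k + 1) w).snap - avg F (X k w).x‖ ^ 2) P :=
    ((hfS.prodMk (hf1.prodMk hf0)).comp fun a => 5 * β / (2 * μ) * (t * (t - 1))
      * ‖estimator F a.1 a.2.2.x a.2.1.snap - avg F a.2.2.x‖ ^ 2).integrable
  have hpt : ∀ w, energy μ β (tSeq μ r (k + 1)) (residual lam (avg F) T (X (k + 1) w).x)
      ((X (k + 1) w).x - (X (k + 1) w).z) ((X (k + 1) w).z - xstar)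
      + t * (t - 1) * (bigLambda L Lhat * meanSqDist F (X (k + 1) w).x (X k w).x)
      ≤ energy μ β t (residual lam (avg F) T (X k w).x)
      ((X k w).x - (X k w).z) ((X k w).z - xstar) + 5 * β / (2 * μ) * (t * (t - 1))
      * ‖estimator F (fun j => S k j w) (X k w).x (X (k + 1) w).snap - avg F (X k w).x‖ ^ 2 := by
    intro w
    obtain ⟨e, he, hxe, hze⟩ := exists_run_succ (x0 := x0) (β := β) (F := F) hT h.lam_pos h.ρ_nonneg
      h.lam_ge (fun k j => S k j w) (fun k => c k w) ht0.ne'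
    have h1 := energy_step (xs := xstar) hμ h.μ_lt hβ h.le_betaBar ht rfl hxe hze
      (residual_cocoercive hF hT h.L_pos h.L_lt h.Lhat_mul_lt h.lam_pos h.ρ_lt_lam _ _)
      (betaBar_mul_le_inner h hF hT hx _)
    rw [tSeq_succ]
    refine h1.trans (add_le_add le_rfl ?_)
    have : 0 ≤ 5 * β / (2 * μ) * (t * (t - 1)) := by positivity
    exact mul_le_mul_of_nonneg_left (pow_le_pow_left₀ (norm_nonneg _) he 2) this
  have h1 := integral_mono (hi1.add hi2) (hi0.add hi3) hpt
  simp only [Pi.add_apply] at h1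
  rw [integral_add hi1 hi2, integral_add hi0 hi3, integral_const_mul, integral_const_mul,
    integral_const_mul] at h1
  refine h1.trans (add_le_add le_rfl ?_)
  exact mul_le_mul_of_nonneg_left (hS.integral_estimator_le hn hb k) (by positivity)

theorem IsSampling.integrable_residual_sq [IsProbabilityMeasure P] (hS : IsSampling P q S c)
    (k : ℕ) : Integrable (fun w => ‖residual lam (avg F) T (X k w).x‖ ^ 2) P :=
  ((hS.isFinitary_randomState k).comp fun st => ‖residual lam (avg F) T st.x‖ ^ 2).integrable

theorem IsSampling.le_meanEnergy [IsProbabilityMeasure P] (hS : IsSampling P q S c)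
    (h : Constants L Lhat ρ lam μ r β cp) (hF : AverageCocoercive L F)
    (hT : MaxCoHypomonotone ρ T) (hx : xstar ∈ zer (avg F) T) (k : ℕ) :
    β / 2 * (tSeq μ r k - μ) ^ 2 * ∫ w, ‖residual lam (avg F) T (X k w).x‖ ^ 2 ∂P
      ≤ meanEnergy P lam μ r β F T x0 xstar S c k := by
  have ht := h.tSeq_gt k
  have hμ := h.μ_pos
  rw [← integral_const_mul]
  refine integral_mono ((hS.integrable_residual_sq k).const_mul _)
    (((hS.isFinitary_randomState k).comp fun st => energy μ β (tSeq μ r k)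
      (residual lam (avg F) T st.x) (st.x - st.z) (st.z - xstar)).integrable) fun w => ?_
  refine energy_ge hμ h.μ_lt h.β_pos h.β_le_betaBar (by linarith) ?_
  rw [sub_add_sub_cancel]
  exact betaBar_mul_le_inner h hF hT hx _

theorem meanEnergy_zero_le [IsProbabilityMeasure P] (h : Constants L Lhat ρ lam μ r β cp) :
    meanEnergy P lam μ r β F T x0 xstar S c 0
      ≤ β * Psi0 lam μ r β (avg F) T x0 xstar ^ 2 := by
  have ht := h.tSeq_gt 0
  have hμ := h.μ_pos
  simp only [tSeq, Nat.cast_zero, zero_add] at ht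
  have hr : 0 < r := by
    by_contra hc
    push Not at hc
    nlinarith
  have h2r : 1 < 2 * r := by nlinarith [h.μ_lt]
  have e : meanEnergy P lam μ r β F T x0 xstar S c 0
      = energy μ β (μ * r) (residual lam (avg F) T x0) 0 (x0 - xstar) := by
    have : ∀ w, energy μ β (tSeq μ r 0) (residual lam (avg F) T (X 0 w).x)
        ((X 0 w).x - (X 0 w).z) ((X 0 w).z - xstar)
        = energy μ β (μ * r) (residual lam (avg F) T x0) 0 (x0 - xstar) := by
      intro w
      change energy μ β (tSeq μ r 0) (residual lam (avg F) T x0) (x0 - x0) (x0 - xstar) = _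
      rw [sub_self, tSeq, Nat.cast_zero, zero_add]
    simp only [meanEnergy, this, integral_const, probReal_univ, one_smul]
  rw [e, Psi0, Real.sq_sqrt]
  · exact energy_init_le hμ h.β_pos (by linarith) _ _
  · have h1 : 0 < μ * r - 1 := by linarith
    have h3 : 0 ≤ 2 * r - 1 := by linarith
    have h4 := h.β_pos
    positivity

end MeanEnergy

end Expectation

/-! ### The switching probabilities -/

section Parameters

variable {L Lhat ρ lam μ r β cp a : ℝ} {n : ℕ}

theorem Constants.shift_gt (h : Constants L Lhat ρ lam μ r β cp) : 4 < r - 1 - 1 / μ := by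
  linarith [h.r_gt]

theorem SizeConditions.two_le (hs : SizeConditions L Lhat μ r β cp a n)
    (h : Constants L Lhat ρ lam μ r β cp) : 2 ≤ cp * (n : ℝ) ^ a := by
  have h1 := hs.large
  rw [one_div, inv_mul_le_iff₀ h.cp_pos] at h1
  refine le_trans ?_ ((le_max_left _ _).trans h1)
  have h2 := mul_lt_mul_of_pos_left h.r_gt h.μ_pos
  rw [mul_add, mul_one_div_cancel h.μ_pos.ne'] at h2
  rw [le_div_iff₀ (by linarith)]
  linarith [h.μ_pos]

theorem SizeConditions.shift_le (hs : SizeConditions L Lhat μ r β cp a n)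
    (h : Constants L Lhat ρ lam μ r β cp) : r - 1 - 1 / μ ≤ 4 * (cp * (n : ℝ) ^ a) := by
  have h1 := hs.large
  rw [one_div, inv_mul_le_iff₀ h.cp_pos] at h1
  have h2 := (le_max_right _ _).trans h1
  have hμ := h.μ_pos
  have e : (μ * (r - 1) - 1) / (4 * μ) = (r - 1 - 1 / μ) / 4 := by field_simp
  rw [e] at h2
  linarith

theorem SizeConditions.batchSize_le (hs : SizeConditions L Lhat μ r β cp a n) :
    (batchSize L Lhat μ β cp a n : ℝ) ≤ batchConst L Lhat μ β cp * (n : ℝ) ^ (2 * a) := by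
  refine Nat.floor_le ?_
  by_contra hc
  push Not at hc
  have := hs.batch
  rw [batchSize, Nat.floor_of_nonpos hc.le] at this
  omega

/-- Rounding down to a positive integer loses at most half of the batch size. -/
theorem SizeConditions.le_batchSize (hs : SizeConditions L Lhat μ r β cp a n)
    (h : Constants L Lhat ρ lam μ r β cp) :
    5 * β / (2 * μ) * (cp * (n : ℝ) ^ a) ^ 2
      ≤ bigLambda L Lhat * batchSize L Lhat μ β cp a n := by
  have h1 : batchConst L Lhat μ β cp * (n : ℝ) ^ (2 * a) < batchSize L Lhat μ β cp a n + 1 :=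
    Nat.lt_floor_add_one _
  have h2 : (1 : ℝ) ≤ batchSize L Lhat μ β cp a n := by exact_mod_cast hs.batch
  have hΛ := h.bigLambda_pos (β := β) (cp := cp)
  have hμ := h.μ_pos
  have e : (n : ℝ) ^ (2 * a) = ((n : ℝ) ^ a) ^ 2 := by
    rw [mul_comm, Real.rpow_mul (Nat.cast_nonneg n), Real.rpow_two]
  have e2 : 5 * β / (2 * μ) * (cp * (n : ℝ) ^ a) ^ 2
      = bigLambda L Lhat * (batchConst L Lhat μ β cp * (n : ℝ) ^ (2 * a) / 2) := by
    rw [batchConst, e]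
    field_simp
  rw [e2]
  exact mul_le_mul_of_nonneg_left (by linarith) hΛ.le

theorem switchProb_eq (hμ : 0 < μ) (k : ℕ) :
    switchProb μ r cp a n k = if (k : ℝ) + (r - 1 - 1 / μ) ≤ 4 * (cp * (n : ℝ) ^ a)
      then 2 / (cp * (n : ℝ) ^ a) + 4 * (1 / ((k : ℝ) + (r - 1 - 1 / μ)))
      else 3 / (cp * (n : ℝ) ^ a) := by
  have e1 : ((k : ℤ) ≤ ⌊4 * cp * (n : ℝ) ^ a - r + 1 + 1 / μ⌋)
      ↔ (k : ℝ) + (r - 1 - 1 / μ) ≤ 4 * (cp * (n : ℝ) ^ a) := by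
    rw [Int.le_floor, Int.cast_natCast]
    constructor <;> intro h <;> linarith
  have e2 : 4 * μ / (μ * ((k : ℝ) + r - 1) - 1) = 4 * (1 / ((k : ℝ) + (r - 1 - 1 / μ))) := by
    have : μ * ((k : ℝ) + r - 1) - 1 = μ * ((k : ℝ) + (r - 1 - 1 / μ)) := by
      field_simp
      ring
    rw [this, mul_div_mul_comm, mul_one_div]
    field_simp
  simp only [switchProb, e1, e2]

theorem switchProb_pos (h : Constants L Lhat ρ lam μ r β cp)
    (hs : SizeConditions L Lhat μ r β cp a n) (k : ℕ) : 0 < switchProb μ r cp a n k := by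
  have h1 := hs.two_le h
  have h2 := h.shift_gt
  have h3 : (0 : ℝ) ≤ k := Nat.cast_nonneg k
  have h4 : 0 < (k : ℝ) + (r - 1 - 1 / μ) := by linarith
  rw [switchProb_eq h.μ_pos]
  split_ifs <;> positivity

/-- With `m = c_p n ^ a` and `q` the relative growth of `t_k - 1`, the switching probability is
large enough for the variance to contract faster than the weights `t_k (t_k - 1)` grow. -/
theorem weight_growth_le {m q P : ℝ} (hm : 2 ≤ m) (hq : 0 ≤ q) (hq4 : q ≤ 1 / 4) (hP : P ≤ 1)
    (h : P = 2 / m + 4 * q ∨ (P = 3 / m ∧ 4 * m * q ≤ 1)) :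
    m * ((1 + q) ^ 2 * (1 - P / 2)) ≤ m - 1 ∧ 2 * (1 + q) ^ 2 ≤ m * P := by
  have hm0 : 0 < m := by linarith
  have hx : m * (1 / m) = 1 := by field_simp
  rcases h with rfl | ⟨rfl, hmq⟩
  · have e : m * ((1 + q) ^ 2 * (1 - (2 / m + 4 * q) / 2))
        = (1 + q) ^ 2 * (m * (1 - 2 * q) - 1) := by
      field_simp
      ring
    have e2 : m * (2 / m + 4 * q) = 2 + 4 * m * q := by field_simp
    rw [e, e2]
    constructor
    · have h1 : (1 + q) ^ 2 * (1 - 2 * q) ≤ 1 := by nlinarith [pow_nonneg hq 3]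
      nlinarith [pow_nonneg hq 2]
    · nlinarith
  · have e : m * ((1 + q) ^ 2 * (1 - (3 / m) / 2)) = (1 + q) ^ 2 * (m - 3 / 2) := by
      field_simp
    have e2 : m * (3 / m) = 3 := by field_simp
    rw [e, e2]
    have hq8 : q ≤ 1 / 8 := by nlinarith
    constructor
    · nlinarith [mul_nonneg hq hq]
    · nlinarith

theorem weight_succ_le (h : Constants L Lhat ρ lam μ r β cp) (k : ℕ) :
    tSeq μ r (k + 1) * (tSeq μ r (k + 1) - 1)
      ≤ (1 + μ / (tSeq μ r k - 1)) ^ 2 * (tSeq μ r k * (tSeq μ r k - 1)) := by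
  have ht := h.tSeq_gt k
  have hμ := h.μ_pos
  rw [tSeq_succ]
  set t := tSeq μ r k
  have hd : 0 < t - 1 := by linarith
  have e : (1 + μ / (t - 1)) ^ 2 * (t * (t - 1)) = (t + μ + μ / (t - 1)) * (t + μ - 1) := by
    field_simp
    ring
  rw [e]
  have : 0 ≤ μ / (t - 1) := by positivity
  exact mul_le_mul_of_nonneg_right (by linarith) (by linarith)

theorem switchProb_contraction (h : Constants L Lhat ρ lam μ r β cp)
    (hs : SizeConditions L Lhat μ r β cp a n) (k : ℕ) (hp : switchProb μ r cp a n (k + 1) ≤ 1) :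
    cp * (n : ℝ) ^ a * (tSeq μ r (k + 1) * (tSeq μ r (k + 1) - 1))
        * (1 - switchProb μ r cp a n (k + 1) / 2)
      ≤ (cp * (n : ℝ) ^ a - 1) * (tSeq μ r k * (tSeq μ r k - 1)) ∧
    2 * (tSeq μ r (k + 1) * (tSeq μ r (k + 1) - 1))
      ≤ cp * (n : ℝ) ^ a * switchProb μ r cp a n (k + 1) * (tSeq μ r k * (tSeq μ r k - 1)) := by
  have ht := h.tSeq_gt k
  have hμ := h.μ_pos
  have hm := hs.two_le h
  have hw := weight_succ_le h k
  have hcase : switchProb μ r cp a n (k + 1)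
      = 2 / (cp * (n : ℝ) ^ a) + 4 * (μ / (tSeq μ r k - 1))
      ∨ (switchProb μ r cp a n (k + 1) = 3 / (cp * (n : ℝ) ^ a)
        ∧ 4 * (cp * (n : ℝ) ^ a) * (μ / (tSeq μ r k - 1)) ≤ 1) := by
    have hd0 : 0 < tSeq μ r k - 1 := by linarith
    have hd : tSeq μ r k - 1 = μ * (((k + 1 : ℕ) : ℝ) + (r - 1 - 1 / μ)) := by
      rw [tSeq]
      push_cast
      field_simp
      ring
    have hs0 : 0 < ((k + 1 : ℕ) : ℝ) + (r - 1 - 1 / μ) := by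
      rw [hd] at hd0
      exact pos_of_mul_pos_right hd0 hμ.le
    have e : μ / (tSeq μ r k - 1) = 1 / (((k + 1 : ℕ) : ℝ) + (r - 1 - 1 / μ)) := by
      rw [hd]
      field_simp
    rw [switchProb_eq hμ, e]
    split_ifs with hc
    · exact Or.inl rfl
    · refine Or.inr ⟨rfl, ?_⟩
      rw [mul_one_div, div_le_one hs0]
      linarith
  set t := tSeq μ r k
  set t' := tSeq μ r (k + 1)
  set m := cp * (n : ℝ) ^ a
  set p := switchProb μ r cp a n (k + 1)
  have hd : 0 < t - 1 := by linarith
  have htt : 0 < t * (t - 1) := mul_pos (by linarith) hd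
  have hq4 : μ / (t - 1) ≤ 1 / 4 := by
    rw [div_le_iff₀ hd]
    linarith
  obtain ⟨h1, h2⟩ := weight_growth_le hm (by positivity) hq4 hp hcase
  have hp2 : 0 ≤ 1 - p / 2 := by linarith
  constructor
  · calc m * (t' * (t' - 1)) * (1 - p / 2)
        = m * (1 - p / 2) * (t' * (t' - 1)) := by ring
      _ ≤ m * (1 - p / 2) * ((1 + μ / (t - 1)) ^ 2 * (t * (t - 1))) :=
          mul_le_mul_of_nonneg_left hw (mul_nonneg (by linarith) hp2)
      _ = m * ((1 + μ / (t - 1)) ^ 2 * (1 - p / 2)) * (t * (t - 1)) := by ring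
      _ ≤ (m - 1) * (t * (t - 1)) := mul_le_mul_of_nonneg_right h1 htt.le
  · calc 2 * (t' * (t' - 1)) ≤ 2 * ((1 + μ / (t - 1)) ^ 2 * (t * (t - 1))) := by linarith
      _ = 2 * (1 + μ / (t - 1)) ^ 2 * (t * (t - 1)) := by ring
      _ ≤ m * p * (t * (t - 1)) := mul_le_mul_of_nonneg_right h2 htt.le

end Parameters

/-! ### The convergence rate -/

/-- If the energy `E` grows by at most a multiple of the variance `D`, and the variance contracts
up to a multiple of the step lengths `G` that the energy pays for, then `E` stays below its initial
value: `E (k + 1) + Λ τ_k G_k + N (m - 1) τ_k D_k / b` is bounded by `E 0`. -/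
theorem le_initial_of_variance_contraction {E D G τ q : ℕ → ℝ} {Λ N m b : ℝ}
    (hΛ : 0 ≤ Λ) (hN : 0 ≤ N) (hm : 1 ≤ m) (hb : 0 < b) (hNb : N * m ^ 2 ≤ Λ * b)
    (hτ : ∀ k, 0 ≤ τ k) (hD : ∀ k, 0 ≤ D k) (hG : ∀ k, 0 ≤ G k) (hq : ∀ k, 0 < q (k + 1))
    (hE : ∀ k, E (k + 1) + τ k * (Λ * G k) ≤ E k + N * τ k * (1 / b * D k))
    (hD0 : D 0 = 0)
    (hDs : ∀ k, D (k + 1) ≤ (1 - q (k + 1) / 2) * D k + 2 / q (k + 1) * G k)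
    (h1 : ∀ k, m * τ (k + 1) * (1 - q (k + 1) / 2) ≤ (m - 1) * τ k)
    (h2 : ∀ k, 2 * τ (k + 1) ≤ m * q (k + 1) * τ k) (k : ℕ) : E k ≤ E 0 := by
  have key : ∀ k, E (k + 1) + τ k * (Λ * G k) + N / b * ((m - 1) * τ k) * D k ≤ E 0 := by
    intro k
    induction k with
    | zero =>
      have := hE 0
      rw [hD0] at this ⊢
      linarith
    | succ k ih =>
      have e := hE (k + 1)
      have hNb0 : 0 ≤ N / b := by positivity
      have s1 : N / b * (m * τ (k + 1)) * D (k + 1) ≤ N / b * (m * τ (k + 1))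
          * ((1 - q (k + 1) / 2) * D k + 2 / q (k + 1) * G k) :=
        mul_le_mul_of_nonneg_left (hDs k)
          (mul_nonneg hNb0 (mul_nonneg (by linarith) (hτ _)))
      have s2 : N / b * (m * τ (k + 1) * (1 - q (k + 1) / 2)) * D k
          ≤ N / b * ((m - 1) * τ k) * D k :=
        mul_le_mul_of_nonneg_right (mul_le_mul_of_nonneg_left (h1 k) hNb0) (hD k)
      have s3 : N / b * (m * τ (k + 1)) * (2 / q (k + 1)) ≤ Λ * τ k := by
        have hqk := hq k
        have e1 : N / b * (m * τ (k + 1)) * (2 / q (k + 1))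
            = N * m * (2 * τ (k + 1)) / (b * q (k + 1)) := by field_simp
        rw [e1, div_le_iff₀ (by positivity)]
        calc N * m * (2 * τ (k + 1)) ≤ N * m * (m * q (k + 1) * τ k) :=
              mul_le_mul_of_nonneg_left (h2 k) (mul_nonneg hN (by linarith))
          _ = N * m ^ 2 * (q (k + 1) * τ k) := by ring
          _ ≤ Λ * b * (q (k + 1) * τ k) :=
              mul_le_mul_of_nonneg_right hNb (mul_nonneg hqk.le (hτ k))
          _ = Λ * τ k * (b * q (k + 1)) := by ring
      have s4 := mul_le_mul_of_nonneg_right s3 (hG k)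
      have e2 : N * τ (k + 1) * (1 / b * D (k + 1)) = N / b * τ (k + 1) * D (k + 1) := by ring
      rw [e2] at e
      linarith
  cases k with
  | zero => exact le_rfl
  | succ k =>
    have h3 := key k
    have h4 : 0 ≤ τ k * (Λ * G k) := mul_nonneg (hτ k) (mul_nonneg hΛ (hG k))
    have h5 : 0 ≤ N / b * ((m - 1) * τ k) * D k :=
      mul_nonneg (mul_nonneg (by positivity) (mul_nonneg (by linarith) (hτ k))) (hD k)
    linarith

section Rate

variable {p n : ℕ} {L Lhat ρ lam μ r β cp a : ℝ}
  {F : Fin n → EuclideanSpace ℝ (Fin p) → EuclideanSpace ℝ (Fin p)}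
  {T : EuclideanSpace ℝ (Fin p) → Set (EuclideanSpace ℝ (Fin p))}
  {x0 xstar : EuclideanSpace ℝ (Fin p)} {Ω : Type*} [MeasurableSpace Ω] {P : Measure Ω}
  [IsProbabilityMeasure P] {S : ℕ → Fin (batchSize L Lhat μ β cp a n) → Ω → Fin n}
  {c : ℕ → Ω → Bool}

theorem integral_residual_sq_le (h : Constants L Lhat ρ lam μ r β cp)
    (hs : SizeConditions L Lhat μ r β cp a n) (hF : AverageCocoercive L F)
    (hT : MaxCoHypomonotone ρ T) (hx : xstar ∈ zer (avg F) T)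
    (hS : IsSampling P (switchProb μ r cp a n) S c) (k : ℕ) :
    (μ * (k + r - 1)) ^ 2
        * ∫ w, ‖residual lam (avg F) T (randomState lam μ r β F T x0 S c k w).x‖ ^ 2 ∂P
      ≤ 2 * Psi0 lam μ r β (avg F) T x0 xstar ^ 2 := by
  have hβ := h.β_pos
  have hμ := h.μ_pos
  have hb : (0 : ℝ) < batchSize L Lhat μ β cp a n := by exact_mod_cast hs.batch
  have h1 := le_initial_of_variance_contraction (N := 5 * β / (2 * μ)) h.bigLambda_pos.le
    (by positivity) (by linarith [hs.two_le h]) hb (hs.le_batchSize h)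
    (τ := fun k => tSeq μ r k * (tSeq μ r k - 1))
    (fun k => mul_nonneg (by linarith [h.tSeq_gt k]) (by linarith [h.tSeq_gt k]))
    (fun k => snapGap_nonneg (P := P) (lam := lam) (r := r) (F := F) (T := T) (x0 := x0)
      (S := S) (c := c) k)
    (fun k => stepGap_nonneg k) (fun k => switchProb_pos h hs (k + 1))
    (fun k => hS.meanEnergy_succ_le (xstar := xstar) h hF hT hx hs.n_pos hs.batch k) snapGap_zero
    (fun k => hS.snapGap_succ_le k (switchProb_pos h hs (k + 1)))
    (fun k => (switchProb_contraction h hs k (hS.switch_mem_Icc (by omega)).2).1)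
    (fun k => (switchProb_contraction h hs k (hS.switch_mem_Icc (by omega)).2).2) k
  have h2 := hS.le_meanEnergy (x0 := x0) h hF hT hx k
  have h3 := meanEnergy_zero_le (P := P) (F := F) (T := T) (x0 := x0) (xstar := xstar) (S := S)
    (c := c) h
  have e : tSeq μ r k - μ = μ * (k + r - 1) := by rw [tSeq]; ring
  rw [e] at h2
  have h4 := h2.trans (h1.trans h3)
  set I := ∫ w, ‖residual lam (avg F) T (randomState lam μ r β F T x0 S c k w).x‖ ^ 2 ∂P
  have h5 : β / 2 * ((μ * (k + r - 1)) ^ 2 * I)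
      ≤ β / 2 * (2 * Psi0 lam μ r β (avg F) T x0 xstar ^ 2) := by linarith
  exact le_of_mul_le_mul_left h5 (by positivity)

end Rate

/-! ### The number of evaluations -/

section Cost

variable {p n : ℕ} {L Lhat ρ lam μ r β cp a : ℝ}
  {F : Fin n → EuclideanSpace ℝ (Fin p) → EuclideanSpace ℝ (Fin p)}
  {T : EuclideanSpace ℝ (Fin p) → Set (EuclideanSpace ℝ (Fin p))}
  {x0 : EuclideanSpace ℝ (Fin p)} {Ω : Type*} [MeasurableSpace Ω] {P : Measure Ω}

theorem IsSampling.integrable_fCalls {b : ℕ} [IsProbabilityMeasure P] {q : ℕ → ℝ}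
    {S : ℕ → Fin b → Ω → Fin n} {c : ℕ → Ω → Bool} (hS : IsSampling P q S c) (k : ℕ) :
    Integrable (fun w => ((randomState lam μ r β F T x0 S c k w).fCalls : ℝ)) P :=
  ((hS.isFinitary_randomState k).comp fun st : State p => (st.fCalls : ℝ)).integrable

theorem IsSampling.integral_fCalls_succ {b : ℕ} [IsProbabilityMeasure P] {q : ℕ → ℝ}
    {S : ℕ → Fin b → Ω → Fin n} {c : ℕ → Ω → Bool} (hS : IsSampling P q S c) (k : ℕ) :
    ∫ w, ((randomState lam μ r β F T x0 S c (k + 1) w).fCalls : ℝ) ∂P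
      = ∫ w, ((randomState lam μ r β F T x0 S c k w).fCalls : ℝ) ∂P
        + (if 1 ≤ k then n * q k else 0) + 2 * b := by
  have e : ∀ w, ((randomState lam μ r β F T x0 S c (k + 1) w).fCalls : ℝ)
      = (randomState lam μ r β F T x0 S c k w).fCalls
        + (if 1 ≤ k ∧ c k w = true then (n : ℝ) else 0) + 2 * b := by
    intro w
    simp only [randomState, run_succ_fCalls]
    push_cast
    rfl
  have hi : Integrable (fun w => if 1 ≤ k ∧ c k w = true then (n : ℝ) else 0) P :=
    (((isFinitary_switch (I := {Sum.inr k}) (S := S) rfl).mono (hS.sampleSigma_le _)).comp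
      fun cb => if 1 ≤ k ∧ cb = true then (n : ℝ) else 0).integrable
  have hf := hS.integrable_fCalls (lam := lam) (μ := μ) (r := r) (β := β) (F := F) (T := T)
    (x0 := x0) k
  have hfi : Integrable (fun w => ((randomState lam μ r β F T x0 S c k w).fCalls : ℝ)
      + if 1 ≤ k ∧ c k w = true then (n : ℝ) else 0) P := hf.add hi
  simp only [e]
  rw [integral_add hfi (integrable_const _), integral_add hf hi, integral_const,
    probReal_univ, one_smul]
  congr 2
  split_ifs with hk
  · have := hS.integral_switch (IsFinitary.const (sampleSigma S c ∅) ()) hk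
      (Set.notMem_empty _) (fun _ cb => if 1 ≤ k ∧ cb = true then (n : ℝ) else 0)
    rw [this]
    simp [hk, mul_comm]
  · simp [hk]

/-- The harmonic part of the switching probabilities sums to at most `log (4 * c_p * n ^ a)`. -/
theorem integral_fCalls_le [IsProbabilityMeasure P]
    {S : ℕ → Fin (batchSize L Lhat μ β cp a n) → Ω → Fin n} {c : ℕ → Ω → Bool}
    (h : Constants L Lhat ρ lam μ r β cp) (hs : SizeConditions L Lhat μ r β cp a n)
    (hS : IsSampling P (switchProb μ r cp a n) S c) (K : ℕ) :
    ∫ w, ((randomState lam μ r β F T x0 S c K w).fCalls : ℝ) ∂P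
      ≤ n + 2 * batchSize L Lhat μ β cp a n * K + n * (3 * K / (cp * (n : ℝ) ^ a))
        + 4 * n * Real.log (4 * (cp * (n : ℝ) ^ a)) := by
  have hm := hs.two_le h
  have hsh := h.shift_gt
  have hsm := hs.shift_le h
  set m := cp * (n : ℝ) ^ a
  set s := r - 1 - 1 / μ
  have key : ∀ K : ℕ, ∫ w, ((randomState lam μ r β F T x0 S c K w).fCalls : ℝ) ∂P
      ≤ n + 2 * batchSize L Lhat μ β cp a n * K + n * (3 * K / m)
        + 4 * n * min (Real.log (K - 1 + s)) (Real.log (4 * m)) := by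
    intro K
    induction K with
    | zero =>
      have e : ∫ w, ((randomState lam μ r β F T x0 S c 0 w).fCalls : ℝ) ∂P = n := by
        have : ∀ w, ((randomState lam μ r β F T x0 S c 0 w).fCalls : ℝ) = n := fun _ => rfl
        simp only [this, integral_const, probReal_univ, one_smul]
      have : 0 ≤ min (Real.log (((0 : ℕ) : ℝ) - 1 + s)) (Real.log (4 * m)) :=
        le_min (Real.log_nonneg (by rw [Nat.cast_zero]; linarith))
          (Real.log_nonneg (by linarith))
      rw [e, Nat.cast_zero, mul_zero, mul_zero, zero_div, mul_zero, add_zero, add_zero]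
      rw [Nat.cast_zero] at this
      have : 0 ≤ 4 * (n : ℝ) * min (Real.log ((0 : ℝ) - 1 + s)) (Real.log (4 * m)) := by
        positivity
      linarith
    | succ K ih =>
      rw [hS.integral_fCalls_succ]
      have hK : (0 : ℝ) ≤ K := Nat.cast_nonneg K
      have hn : (0 : ℝ) ≤ n := Nat.cast_nonneg n
      have hm0 : 0 < m := by linarith
      have hKs : 0 < (K : ℝ) + s := by linarith
      have e1 : ((K + 1 : ℕ) : ℝ) - 1 + s = K + s := by push_cast; ring
      rw [e1]
      have hmono : min (Real.log (K - 1 + s)) (Real.log (4 * m))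
          ≤ min (Real.log (K + s)) (Real.log (4 * m)) :=
        min_le_min_right _ (Real.log_le_log (by linarith) (by linarith))
      -- one more term of the sum is bounded by the increment of the logarithm
      have hp : switchProb μ r cp a n K ≤ 3 / m
          + 4 * (min (Real.log (K + s)) (Real.log (4 * m))
            - min (Real.log (K - 1 + s)) (Real.log (4 * m))) := by
        rw [switchProb_eq h.μ_pos]
        split_ifs with hc
        · have hc' : (K : ℝ) + s ≤ 4 * m := hc
          rw [min_eq_left (Real.log_le_log hKs hc'),
            min_eq_left (Real.log_le_log (by linarith) (by linarith))]
          have hl : 1 / ((K : ℝ) + s) ≤ Real.log (K + s) - Real.log (K - 1 + s) := by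
            rw [← neg_le_neg_iff, neg_sub, ← Real.log_div (by linarith) hKs.ne']
            refine (Real.log_le_sub_one_of_pos (div_pos (by linarith) hKs)).trans
              (le_of_eq ?_)
            field_simp
            ring
          have : 2 / m ≤ 3 / m := by gcongr; norm_num
          change 2 / m + 4 * (1 / ((K : ℝ) + s)) ≤ _
          linarith
        · change 3 / m ≤ _
          linarith
      have hif : (if 1 ≤ K then (n : ℝ) * switchProb μ r cp a n K else 0) ≤ n * (3 / m
          + 4 * (min (Real.log (K + s)) (Real.log (4 * m))
            - min (Real.log (K - 1 + s)) (Real.log (4 * m)))) := by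
        split_ifs
        · exact mul_le_mul_of_nonneg_left hp hn
        · exact mul_nonneg hn (add_nonneg (by positivity) (by linarith))
      have e2 : (n : ℝ) * (3 * ((K + 1 : ℕ) : ℝ) / m) = n * (3 * K / m) + n * (3 / m) := by
        push_cast; ring
      rw [e2]
      push_cast
      linarith
  refine (key K).trans (add_le_add le_rfl ?_)
  exact mul_le_mul_of_nonneg_left (min_le_right _ _) (by positivity)

/-- The slack `8 * n ≥ 1` absorbs the rounding in `complexity`. -/
theorem cost_add_one_le {K : ℕ} {Q : ℝ} (h : Constants L Lhat ρ lam μ r β cp)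
    (hs : SizeConditions L Lhat μ r β cp a n) (hK : (K : ℝ) ≤ Q) :
    (n + 2 * batchSize L Lhat μ β cp a n * K + n * (3 * K / (cp * (n : ℝ) ^ a))
        + 4 * n * Real.log (4 * (cp * (n : ℝ) ^ a))) + 1
      ≤ n + 4 * n * (2 + Real.log (4 * cp * (n : ℝ) ^ a)) + Q
        * (2 * batchConst L Lhat μ β cp * (n : ℝ) ^ (2 * a) + 3 * (n : ℝ) ^ (1 - a) / cp) := by
  have hn : (1 : ℝ) ≤ n := by exact_mod_cast hs.n_pos
  have hn0 : (0 : ℝ) < n := by linarith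
  have hcp := h.cp_pos
  have e1 : (n : ℝ) * (3 * K / (cp * (n : ℝ) ^ a)) = K * (3 * (n : ℝ) ^ (1 - a) / cp) := by
    rw [Real.rpow_sub hn0, Real.rpow_one]
    have := Real.rpow_pos_of_pos hn0 a
    field_simp
  have hb := hs.batchSize_le
  have hb0 : (0 : ℝ) ≤ batchSize L Lhat μ β cp a n := Nat.cast_nonneg _
  have hr0 : 0 ≤ 3 * (n : ℝ) ^ (1 - a) / cp := by positivity
  have hK0 : (0 : ℝ) ≤ K := Nat.cast_nonneg _
  have h1 : (K : ℝ) * (2 * batchSize L Lhat μ β cp a n + 3 * (n : ℝ) ^ (1 - a) / cp)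
      ≤ Q * (2 * batchConst L Lhat μ β cp * (n : ℝ) ^ (2 * a) + 3 * (n : ℝ) ^ (1 - a) / cp) :=
    mul_le_mul hK (by linarith) (by linarith) (hK0.trans hK)
  rw [e1, ← mul_assoc 4 cp]
  linarith

theorem natCast_le_complexity {K : ℕ} {Ψ ε : ℝ} (h : Constants L Lhat ρ lam μ r β cp)
    (hs : SizeConditions L Lhat μ r β cp a n) (hK : (K : ℝ) ≤ √2 * Ψ / (μ * ε)) :
    (K : ℝ) ≤ complexity L Lhat μ β cp a n Ψ ε := by
  have h1 := cost_add_one_le h hs hK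
  have h2 : (1 : ℝ) ≤ batchSize L Lhat μ β cp a n := by exact_mod_cast hs.batch
  have h3 : (0 : ℝ) ≤ K := Nat.cast_nonneg _
  have hm := hs.two_le h
  have h4 : 0 ≤ 4 * (n : ℝ) * Real.log (4 * (cp * (n : ℝ) ^ a)) :=
    mul_nonneg (by positivity) (Real.log_nonneg (by linarith))
  have h5 : 0 ≤ (n : ℝ) * (3 * K / (cp * (n : ℝ) ^ a)) := by positivity
  have h6 : (0 : ℝ) ≤ n := Nat.cast_nonneg _
  have : (K : ℤ) ≤ complexity L Lhat μ β cp a n Ψ ε := by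
    rw [complexity, Int.le_floor, Int.cast_natCast]
    nlinarith
  exact_mod_cast this

theorem cost_le_complexity {K : ℕ} {Ψ ε : ℝ} (h : Constants L Lhat ρ lam μ r β cp)
    (hs : SizeConditions L Lhat μ r β cp a n) (hK : (K : ℝ) ≤ √2 * Ψ / (μ * ε)) :
    n + 2 * batchSize L Lhat μ β cp a n * K + n * (3 * K / (cp * (n : ℝ) ^ a))
        + 4 * n * Real.log (4 * (cp * (n : ℝ) ^ a))
      ≤ (complexity L Lhat μ β cp a n Ψ ε : ℝ) := by
  have h1 := cost_add_one_le h hs hK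
  have h2 := Int.lt_floor_add_one ((n : ℝ) + 4 * n * (2 + Real.log (4 * cp * (n : ℝ) ^ a))
    + √2 * Ψ / (μ * ε)
      * (2 * batchConst L Lhat μ β cp * (n : ℝ) ^ (2 * a) + 3 * (n : ℝ) ^ (1 - a) / cp))
  rw [complexity]
  linarith

theorem complexity_one_third_le {Ψ Ψmax ε : ℝ} (h : Constants L Lhat ρ lam μ r β cp)
    (hn : 2 ≤ n) (hε : 0 < ε) (hΨ : Ψ ≤ Ψmax) :
    (complexity L Lhat μ β cp (1 / 3) n Ψ ε : ℝ)
      ≤ ((9 + 4 * |Real.log (4 * cp)|) / Real.log 2 + 4 / 3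
          + √2 * |Ψmax| / μ * (2 * batchConst L Lhat μ β cp + 3 / cp))
        * (n * Real.log n + (n : ℝ) ^ (2 / 3 : ℝ) / ε) := by
  have hn2 : (2 : ℝ) ≤ n := by exact_mod_cast hn
  have hn0 : (0 : ℝ) < n := by linarith
  have hcp := h.cp_pos
  have hμ := h.μ_pos
  have hβ := h.β_pos
  have hΛ := h.bigLambda_pos
  have hl2 : 0 < Real.log 2 := Real.log_pos (by norm_num)
  have hln : Real.log 2 ≤ Real.log n := Real.log_le_log (by norm_num) hn2
  have hcb : 0 < batchConst L Lhat μ β cp := by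
    rw [batchConst]
    positivity
  set A := (9 + 4 * |Real.log (4 * cp)|) / Real.log 2 with hA
  set B := √2 * |Ψmax| / μ * (2 * batchConst L Lhat μ β cp + 3 / cp) with hB
  have hA0 : 0 ≤ A := by positivity
  have hB0 : 0 ≤ B := by positivity
  have hlog : Real.log (4 * cp * (n : ℝ) ^ (1 / 3 : ℝ))
      = Real.log (4 * cp) + 1 / 3 * Real.log n := by
    rw [Real.log_mul (by positivity) (by positivity), Real.log_rpow hn0]
  have e1 : (n : ℝ) + 4 * n * (2 + Real.log (4 * cp * (n : ℝ) ^ (1 / 3 : ℝ)))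
      ≤ (A + 4 / 3) * (n * Real.log n) := by
    rw [hlog]
    have h1 : 9 + 4 * |Real.log (4 * cp)| ≤ A * Real.log n := by
      rw [hA, div_mul_eq_mul_div, le_div_iff₀ hl2]
      exact mul_le_mul_of_nonneg_left hln (by positivity)
    have h2 := le_abs_self (Real.log (4 * cp))
    have h3 := mul_le_mul_of_nonneg_left
      (show 9 + 4 * Real.log (4 * cp) ≤ A * Real.log n by linarith) hn0.le
    linarith
  have e2 : √2 * Ψ / (μ * ε) * (2 * batchConst L Lhat μ β cp * (n : ℝ) ^ (2 * (1 / 3) : ℝ)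
      + 3 * (n : ℝ) ^ (1 - 1 / 3 : ℝ) / cp) ≤ B * ((n : ℝ) ^ (2 / 3 : ℝ) / ε) := by
    rw [show (2 * (1 / 3) : ℝ) = 2 / 3 by norm_num, show (1 - 1 / 3 : ℝ) = 2 / 3 by norm_num]
    have h1 : B * ((n : ℝ) ^ (2 / 3 : ℝ) / ε) = √2 * |Ψmax| / (μ * ε)
        * (2 * batchConst L Lhat μ β cp * (n : ℝ) ^ (2 / 3 : ℝ)
          + 3 * (n : ℝ) ^ (2 / 3 : ℝ) / cp) := by
      rw [hB]
      field_simp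
    rw [h1]
    have := hΨ.trans (le_abs_self Ψmax)
    gcongr
  have h4 : 0 ≤ (n : ℝ) * Real.log n := mul_nonneg hn0.le (by linarith)
  have h5 : 0 ≤ (n : ℝ) ^ (2 / 3 : ℝ) / ε := by positivity
  refine (Int.floor_le _).trans ((add_le_add e1 e2).trans ?_)
  have h6 := mul_nonneg hB0 h4
  have h7 := mul_nonneg (show 0 ≤ A + 4 / 3 by linarith) h5
  linarith

end Cost

end VFOSA

theorem mainTheorem7 (L Lhat ρ lam μ r β cp Ψmax : ℝ)
    (hconst : VFOSA.Constants L Lhat ρ lam μ r β cp) :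
    ∃ C : ℝ, ∀ (n p : ℕ) (a : ℝ)
      (F : Fin n → EuclideanSpace ℝ (Fin p) → EuclideanSpace ℝ (Fin p))
      (T : EuclideanSpace ℝ (Fin p) → Set (EuclideanSpace ℝ (Fin p)))
      (x0 xstar : EuclideanSpace ℝ (Fin p)),
      VFOSA.SizeConditions L Lhat μ r β cp a n →
      VFOSA.AverageCocoercive L F →
      VFOSA.MaxCoHypomonotone ρ T →
      xstar ∈ VFOSA.zer (VFOSA.avg F) T →
      ∀ (Ω : Type*) [MeasurableSpace Ω] (P : Measure Ω) [IsProbabilityMeasure P]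
        (S : ℕ → Fin (VFOSA.batchSize L Lhat μ β cp a n) → Ω → Fin n) (c : ℕ → Ω → Bool),
      VFOSA.IsSampling P (VFOSA.switchProb μ r cp a n) S c →
      ∀ ε : ℝ, 0 < ε →
        let state : ℕ → Ω → VFOSA.State p := fun k w =>
          VFOSA.run lam μ r β F T x0 (fun k j => S k j w) (fun k => c k w) k
        let Ψ := VFOSA.Psi0 lam μ r β (VFOSA.avg F) T x0 xstar
        let bound : ℝ := VFOSA.complexity L Lhat μ β cp a n Ψ ε
        ∃ K : ℕ,
          (Integrable (fun w => ‖VFOSA.residual lam (VFOSA.avg F) T (state K w).x‖ ^ 2) P ∧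
            ∫ w, ‖VFOSA.residual lam (VFOSA.avg F) T (state K w).x‖ ^ 2 ∂P ≤ ε ^ 2) ∧
          (Integrable (fun w => ((state K w).fCalls : ℝ)) P ∧
            ∫ w, ((state K w).fCalls : ℝ) ∂P ≤ bound) ∧
          (∀ w, ((state K w).jCalls : ℝ) ≤ √2 * Ψ / (μ * ε) ∧ ((state K w).jCalls : ℝ) ≤ bound) ∧
          (a = 1 / 3 → 2 ≤ n → Ψ ≤ Ψmax →
            bound ≤ C * (n * Real.log n + (n : ℝ) ^ (2 / 3 : ℝ) / ε) ∧
            ∫ w, (((state K w).fCalls : ℝ) + ((state K w).jCalls : ℝ)) ∂P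
              ≤ C * (n * Real.log n + (n : ℝ) ^ (2 / 3 : ℝ) / ε)) := by
  -- twice the constant for `complexity`, which bounds both kinds of evaluations
  refine ⟨2 * ((9 + 4 * |Real.log (4 * cp)|) / Real.log 2 + 4 / 3
    + √2 * |Ψmax| / μ * (2 * VFOSA.batchConst L Lhat μ β cp + 3 / cp)), ?_⟩
  intro n p a F T x0 xstar hs hF hT hx Ω _ P _ S c hS ε hε state Ψ bound
  have hμ := hconst.μ_pos
  have hΨ0 : 0 ≤ Ψ := Real.sqrt_nonneg _
  set K := ⌊√2 * Ψ / (μ * ε)⌋₊ with hKd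
  have hK : (K : ℝ) ≤ √2 * Ψ / (μ * ε) := Nat.floor_le (by positivity)
  have hK1 : √2 * Ψ / (μ * ε) < K + 1 := Nat.lt_floor_add_one _
  have hj : ∀ w, (state K w).jCalls = K := fun w => VFOSA.run_jCalls _ _ K
  have hf : ∫ w, ((state K w).fCalls : ℝ) ∂P ≤ bound :=
    (VFOSA.integral_fCalls_le hconst hs hS K).trans (VFOSA.cost_le_complexity hconst hs hK)
  have hKb : (K : ℝ) ≤ bound := VFOSA.natCast_le_complexity hconst hs hK
  have hfi : Integrable (fun w => ((state K w).fCalls : ℝ)) P := hS.integrable_fCalls K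
  refine ⟨K, ⟨hS.integrable_residual_sq K, ?_⟩, ⟨hfi, hf⟩, fun w => ?_, ?_⟩
  · have h1 := VFOSA.integral_residual_sq_le (x0 := x0) hconst hs hF hT hx hS K
    change _ * (∫ w, ‖VFOSA.residual lam (VFOSA.avg F) T (state K w).x‖ ^ 2 ∂P) ≤ 2 * Ψ ^ 2 at h1
    set I := ∫ w, ‖VFOSA.residual lam (VFOSA.avg F) T (state K w).x‖ ^ 2 ∂P
    have hr : 2 ≤ r := by
      have := hconst.shift_gt
      have : 0 < 1 / μ := by positivity
      linarith
    set τ := μ * ((K : ℝ) + r - 1) with hτ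
    have hτ0 : 0 < τ := mul_pos hμ (by linarith [Nat.cast_nonneg (α := ℝ) K])
    have h2 : √2 * Ψ ≤ τ * ε := by
      rw [div_lt_iff₀ (by positivity)] at hK1
      have : (K + 1) * (μ * ε) ≤ (K + r - 1) * (μ * ε) :=
        mul_le_mul_of_nonneg_right (by linarith) (by positivity)
      rw [hτ]
      linarith
    have h3 := pow_le_pow_left₀ (by positivity) h2 2
    rw [mul_pow, mul_pow, Real.sq_sqrt (by norm_num)] at h3
    exact le_of_mul_le_mul_left (h1.trans h3) (by positivity)
  · rw [hj w]
    exact ⟨hK, hKb⟩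
  · rintro rfl hn hΨ
    have h1 := VFOSA.complexity_one_third_le hconst hn hε hΨ
    have h2 : (0 : ℝ) ≤ bound := (Nat.cast_nonneg K).trans hKb
    have h3 : ∫ w, (((state K w).fCalls : ℝ) + ((state K w).jCalls : ℝ)) ∂P
        = ∫ w, ((state K w).fCalls : ℝ) ∂P + K := by
      simp only [hj]
      rw [integral_add hfi (integrable_const _), integral_const, probReal_univ, one_smul]
    rw [h3, mul_assoc]
    change bound ≤ _ at h1
    constructor <;> linarith
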